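/- Let $I=[0,1]$, $I^\circ=(0,1)$. A (Feller) diffusion on $I$ is a Feller Markov process on $I$ with continuous paths whose generator $A$, with domain $\mathcal D_A\subset C(I)\cap C^2(I^\circ)$, has on $I^\circ$ the form $Af=\frac12 b f''+a f'$, where $a,b\in C(I^\circ)$ and $b>0$; it is regular if every point of $I^\circ$ is reached with positive probability from every point of $I^\circ$. Put $s(x)=\exp\{-\int_{1/2}^x \frac{2a(y)}{b(y)}\,dy\}$, $S(x)=\int_{1/2}^x s(y)\,dy$, $m=\frac1{sb}$, $M(x)=\int_{1/2}^x m(y)\,dy$, and, for a fixed $x\in I^\circ$, $$N(0)=\int_0^x [S(x)-S(\eta)]\,m(\eta)\,d\eta,\qquad \Sigma(0)=\int_0^x [M(x)-M(\eta)]\,s(\eta)\,d\eta,$$ $$N(1)=\int_x^1 [S(\eta)-S(x)]\,m(\eta)\,d\eta,\qquad \Sigma(1)=\int_x^1 [M(\eta)-M(x)]\,s(\eta)\,d\eta.$$ A boundary point $e\in\{0,1\}$ is entrance if $N(e)<\infty=\Sigma(e)$, exit if $\Sigma(e)<\infty=N(e)$, and regular if $N(e)<\infty$ and $\Sigma(e)<\infty$.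 A regular boundary point $e$ is (instantaneously) reflecting if $f'(x)/s(x)\to 0$ as $x\to e$, $x\in I^\circ$, for every $f\in\mathcal D_A$, and it is (regular) absorbing if $(Af)(e)=0$ for every $f\in\mathcal D_A$. Let $X$ be a regular diffusion on $I$ with initial distribution $\Pi_0$ and generator $A$ (with coefficients $a,b$), such that each of the boundary points $0$ and $1$ is either reflecting or entrance, and assume that $b\in C^1(I^\circ)$. Let $\pi=m/\int_0^1 m(y)\,dy$, $\Pi(x)=\int_0^x\pi(y)\,dy$, and let $(\Lambda f)(x)=\int_0^x \frac{\pi(y)}{\Pi(x)}f(y)\,dy$ for $0<x\le1$, $(\Lambda f)(0)=f(0)$. Let $X^*$ be a diffusion on $I$ with initial distribution $\Pi_0^*$ and generator $A^*$ that is a strong stationary dual of $X$, that is: $\Lambda$ maps $\mathcal D_A$ into $\mathcal D_{A^*}$, $\Lambda A=A^*\Lambda$ on $\mathcal D_A$, and $\int f\,d\Pi_0=\int \Lambda f\,d\Pi_0^*$ for every bounded measurable $f:I\to\mathbb R$. Then $$(A^*f)(x)=\left(\tfrac12 b'(x)-a(x)+b(x)\frac{\pi(x)}{\Pi(x)}\right)f'(x)+\tfrac12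 b(x)f''(x)\qquad (x\in I^\circ,\ f\in\mathcal D_{A^*}),$$ and $0$ is an entrance boundary for $X^*$. If $1$ is a reflecting boundary of $X$, then $1$ is a regular absorbing boundary of $X^*$; if $1$ is an entrance boundary of $X$, then $1$ is an exit boundary of $X^*$. -/

import Mathlib

open Set Filter MeasureTheory
open scoped NNReal ENNReal Topology unitInterval

noncomputable section

/-- The space of continuous paths `[0, ∞) → [0, 1]`, with the σ-field generated by the
coordinate maps. -/
abbrev PathSpace : Type := {ω : ℝ≥0 → I // Continuous ω}

/-- The σ-field generated by the coordinates up to time `s`. -/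
abbrev pastField (s : ℝ≥0) : MeasurableSpace PathSpace :=
  ⨆ u : Iic s, MeasurableSpace.comap (fun ω : PathSpace => ω.1 u) inferInstance

/-- A (conservative) Feller process on `[0, 1]` with continuous paths: the laws `law x` of the
path started at `x`, with the Markov property, such that the transition operators
`f ↦ (x ↦ E_x f(X_t))` form a Feller semigroup on `C[0, 1]`. -/
structure FellerProcess where
  law : I → Measure PathSpace
  law_prob : ∀ x, IsProbabilityMeasure (law x)
  law_start : ∀ x, ∀ᵐ ω ∂(law x), ω.1 0 = x
  /-- The transition operators preserve `C[0, 1]`. -/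
  feller : ∀ (t : ℝ≥0) (f : C(I, ℝ)), Continuous fun x => ∫ ω, f (ω.1 t) ∂(law x)
  /-- The Markov property `E_x[f(X_{s+t}) | past up to s] = (T_t f)(X_s)`. -/
  markov : ∀ (x : I) (s t : ℝ≥0) (f : C(I, ℝ)) (E : Set PathSpace),
    MeasurableSet[pastField s] E →
      ∫ ω in E, f (ω.1 (s + t)) ∂(law x)
        = ∫ ω in E, (∫ η, f (η.1 t) ∂(law (ω.1 s))) ∂(law x)
  /-- Strong continuity of the semigroup in the uniform norm. -/
  strong_cont : ∀ f : C(I, ℝ),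
    Tendsto (fun t : ℝ≥0 => (⟨_, feller t f⟩ : C(I, ℝ))) (𝓝[>] 0) (𝓝 f)

namespace FellerProcess

/-- The transition semigroup `(T_t f)(x) = E_x f(X_t)` on `C[0, 1]`. -/
def T (X : FellerProcess) (t : ℝ≥0) (f : C(I, ℝ)) : C(I, ℝ) :=
  ⟨fun x => ∫ ω, f (ω.1 t) ∂(X.law x), X.feller t f⟩

/-- `f` is in the domain of the infinitesimal generator and the generator maps `f` to `g`:
`(T_t f - f) / t → g` uniformly as `t ↓ 0`. -/
def HasGen (X : FellerProcess) (f g : C(I, ℝ)) : Prop :=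
  Tendsto (fun t : ℝ≥0 => (t : ℝ)⁻¹ • (X.T t f - f)) (𝓝[>] 0) (𝓝 g)

/-- The domain of the infinitesimal generator. -/
def domain (X : FellerProcess) : Set C(I, ℝ) := {f | ∃ g, X.HasGen f g}

end FellerProcess

/-- A function on `[0, 1]` as a function of a real variable (constant outside `[0, 1]`), so that
derivatives at interior points can be written down. -/
def realExt (f : I → ℝ) : ℝ → ℝ := IccExtend (zero_le_one' ℝ) f

/-- A Feller diffusion on `[0, 1]` with a given initial distribution: on the interior its generator
is `(1/2) b d²/dx² + a d/dx`, with `a`, `b` continuous and `b > 0`, and the domain consists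
of functions in `C[0, 1] ∩ C²(0, 1)`. Only the values of `a`, `b` on `(0, 1)` matter. -/
structure FellerDiffusion extends FellerProcess where
  init : Measure I
  init_prob : IsProbabilityMeasure init
  a : ℝ → ℝ
  b : ℝ → ℝ
  a_cont : ContinuousOn a (Ioo 0 1)
  b_cont : ContinuousOn b (Ioo 0 1)
  b_pos : ∀ x ∈ Ioo (0 : ℝ) 1, 0 < b x
  dom_C2 : ∀ f g : C(I, ℝ), toFellerProcess.HasGen f g → ContDiffOn ℝ 2 (realExt f) (Ioo 0 1)
  gen_eq : ∀ f g : C(I, ℝ), toFellerProcess.HasGen f g →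
    ∀ x : I, (x : ℝ) ∈ Ioo (0 : ℝ) 1 →
      g x = 1 / 2 * b x * deriv (deriv (realExt f)) x + a x * deriv (realExt f) x

namespace FellerDiffusion

variable (X : FellerDiffusion)

/-- Regularity: every interior point is hit with positive probability from every
interior point. -/
def Regular : Prop :=
  ∀ x y : I, (x : ℝ) ∈ Ioo (0 : ℝ) 1 → (y : ℝ) ∈ Ioo (0 : ℝ) 1 →
    0 < X.law x {ω | ∃ t : ℝ≥0, ω.1 t = y}

/-- The scale density `s(x) = exp(-∫^x 2a/b)`, with base point `1/2`. -/
def s (x : ℝ) : ℝ := Real.exp (-∫ y in (1 / 2 : ℝ)..x, 2 * X.a y / X.b y)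

/-- The scale function. -/
def S (x : ℝ) : ℝ := ∫ y in (1 / 2 : ℝ)..x, X.s y

/-- The speed density `m = 1 / (s b)`. -/
def m (x : ℝ) : ℝ := (X.s x * X.b x)⁻¹

/-- The speed function. -/
def M (x : ℝ) : ℝ := ∫ y in (1 / 2 : ℝ)..x, X.m y

/-- `N(0) = ∫_{(0,x]} [S(x) - S(η)] M(dη)` with `x = 1/2`; its finiteness does not depend on the
choice of the interior point `x`. The same holds for the next three quantities. -/
def N0 : ℝ≥0∞ := ∫⁻ y in Ioc (0 : ℝ) (1 / 2), ENNReal.ofReal ((X.S (1 / 2) - X.S y) * X.m y)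

/-- `Σ(0) = ∫_{(0,x]} [M(x) - M(η)] S(dη)`. -/
def Sigma0 : ℝ≥0∞ := ∫⁻ y in Ioc (0 : ℝ) (1 / 2), ENNReal.ofReal ((X.M (1 / 2) - X.M y) * X.s y)

/-- `N(1) = ∫_{[x,1)} [S(η) - S(x)] M(dη)`. -/
def N1 : ℝ≥0∞ := ∫⁻ y in Ico (1 / 2 : ℝ) 1, ENNReal.ofReal ((X.S y - X.S (1 / 2)) * X.m y)

/-- `Σ(1) = ∫_{[x,1)} [M(η) - M(x)] S(dη)`. -/
def Sigma1 : ℝ≥0∞ := ∫⁻ y in Ico (1 / 2 : ℝ) 1, ENNReal.ofReal ((X.M y - X.M (1 / 2)) * X.s y)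

/-- `0` is an entrance boundary. -/
def Entrance0 : Prop := X.N0 < ∞ ∧ X.Sigma0 = ∞

/-- `1` is an entrance boundary. -/
def Entrance1 : Prop := X.N1 < ∞ ∧ X.Sigma1 = ∞

/-- `1` is an exit boundary. -/
def Exit1 : Prop := X.N1 = ∞ ∧ X.Sigma1 < ∞

/-- `0` is a regular boundary. -/
def RegularBoundary0 : Prop := X.N0 < ∞ ∧ X.Sigma0 < ∞

/-- `1` is a regular boundary. -/
def RegularBoundary1 : Prop := X.N1 < ∞ ∧ X.Sigma1 < ∞

/-- `0` is a regular, instantaneously reflecting boundary: `df/dS(0+) = 0` for all `f` in the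
domain of the generator. -/
def Reflecting0 : Prop :=
  X.RegularBoundary0 ∧
    ∀ f ∈ X.domain, Tendsto (fun x => deriv (realExt f) x / X.s x) (𝓝[>] (0 : ℝ)) (𝓝 0)

/-- `1` is a regular, instantaneously reflecting boundary: `df/dS(1-) = 0` for all `f` in the
domain of the generator. -/
def Reflecting1 : Prop :=
  X.RegularBoundary1 ∧
    ∀ f ∈ X.domain, Tendsto (fun x => deriv (realExt f) x / X.s x) (𝓝[<] (1 : ℝ)) (𝓝 0)

/-- `1` is a regular absorbing boundary: it is regular and the generator maps every function of its
domain to a function that vanishes at `1`. -/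
def RegularAbsorbing1 : Prop :=
  X.RegularBoundary1 ∧ ∀ f g : C(I, ℝ), X.HasGen f g → g 1 = 0

/-- The density `π` of the normalized speed measure. -/
def statDensity (x : ℝ) : ℝ := X.m x / ∫ y in (0 : ℝ)..1, X.m y

/-- The distribution function `Π(x) = ∫_0^x π(y) dy`. -/
def statCDF (x : ℝ) : ℝ := ∫ y in (0 : ℝ)..x, X.statDensity y

open Classical in
/-- The link `(Λ f)(x) = ∫_0^x (π(y) / Π(x)) f(y) dy` for `x > 0`, and `(Λ f)(0) = f(0)`. -/
def link (f : I → ℝ) (x : I) : ℝ :=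
  if x = 0 then f 0
  else ∫ y in (0 : ℝ)..x, X.statDensity y / X.statCDF x * realExt f y

end FellerDiffusion

/-- `Xs` is a strong stationary dual of `X`: the link `Λ` of `X` maps the domain of the
generator `A` of `X` into that of the generator `A*` of `Xs`, `Λ A = A* Λ` on the domain of
`A`, and the initial distributions satisfy `(Π₀, f) = (Π₀*, Λ f)` for every bounded
measurable `f`. -/
structure IsStrongStationaryDual (X Xs : FellerDiffusion) : Prop where
  maps_domain : ∀ f ∈ X.domain, ∃ F ∈ Xs.domain, ⇑F = X.link f
  intertwine : ∀ f g F G : C(I, ℝ), X.HasGen f g → Xs.HasGen F G →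
    ⇑F = X.link f → ⇑G = X.link g
  initial : ∀ f : I → ℝ, Measurable f → (∃ C, ∀ x, |f x| ≤ C) →
    ∫ x, f x ∂X.init = ∫ x, X.link f x ∂Xs.init

end

/-!
The speed density `m` of `X` is integrable on `(0, 1)`, and every `f` in the domain `D` of the
generator `A` satisfies `f' / s → 0` at both ends: this is the definition of a reflecting boundary,
and at an entrance boundary it holds because a nonzero limit would make `s` integrable there
(`tendsto_flux`). Since `(f' / s)' = 2 m A f`, it follows that `Λ A f = f' / (2 Π s ∫ dM)`
(`link_gen_eq`) and `(Λ A f)(1) = 0`.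

The domain is as large as these boundary conditions permit. Indeed `1 - A` maps `D` onto `C[0, 1]`
by the resolvent of the Feller semigroup (`exists_hasGen_sub_eq`), and `u = A u` with vanishing flux
at both ends forces `u = 0`, because `u u' / s` is then nondecreasing with limit `0` at both ends
(`InteriorGen.eq_zero`). In particular `D` contains all compactly supported `C²` functions on
`(0, 1)`.

By `(Λ f)' = (π / Π) (f - Λ f)` the intertwining relation becomes, at each interior point, a linear
relation between `f - Λ f` and `f'` whose coefficients involve those of `A*`
(`intertwining_relation`). Two functions, `φ` and `(y - x) φ(y)` with `φ` a bump at `x`, determine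
both coefficients (`dual_coefficients`).

Consequently `s* = C m / Π²` and `m* = s Π² / C`. At `0`, integration by parts bounds `N*(0)` by
`N(0)`, and `s*` is not integrable because `1 / Π` is unbounded (`dual_entrance0`). At `1`, `Π` is
bounded above and below, so scale and speed are exchanged up to bounded factors (`dual_boundary1`).

Absorption at `1` has to be shown on the whole domain of `A*`, not only on `Λ D`. For `h = f - A f`,
the function `F = Λ f` solves `F - A* F = Λ h` and has `(A* F)(1) = 0`. The functions `Λ h` form a
subalgebra of `C[0, 1]` that separates points, hence a dense one, and `A*` is dissipative, so
`(A* F)(1) = 0` passes to the limit (`dual_gen_one_eq_zero`).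
-/

noncomputable section

/-! ### The semigroup and its resolvent -/

namespace FellerProcess

variable (X : FellerProcess)

lemma measurable_coord (t : ℝ≥0) : Measurable fun ω : PathSpace => ω.1 t :=
  (measurable_pi_apply t).comp measurable_subtype_coe

lemma integrable_coord (x : I) (t : ℝ≥0) (f : C(I, ℝ)) :
    Integrable (fun ω : PathSpace => f (ω.1 t)) (X.law x) := by
  have := X.law_prob x
  refine Integrable.of_bound (C := ‖f‖)
    (f.continuous.measurable.comp (measurable_coord t)).aestronglyMeasurable ?_
  exact Eventually.of_forall fun ω => f.norm_coe_le_norm _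

lemma norm_T_le (t : ℝ≥0) (f : C(I, ℝ)) : ‖X.T t f‖ ≤ ‖f‖ := by
  rw [ContinuousMap.norm_le _ (norm_nonneg _)]
  intro x
  have := X.law_prob x
  have := norm_integral_le_of_norm_le_const (μ := X.law x) (f := fun ω => f (ω.1 t)) (C := ‖f‖)
    (Eventually.of_forall fun ω => f.norm_coe_le_norm _)
  simpa [T] using this

/-- The transition operator as a continuous linear map on `C[0, 1]`. -/
def TL (t : ℝ≥0) : C(I, ℝ) →L[ℝ] C(I, ℝ) :=
  LinearMap.mkContinuous
    { toFun := X.T t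
      map_add' := fun f g => by
        ext x
        exact integral_add (X.integrable_coord x t f) (X.integrable_coord x t g)
      map_smul' := fun c f => by
        ext x
        exact integral_const_mul c _ }
    1 (fun f => by simpa using X.norm_T_le t f)

@[simp] lemma TL_apply (t : ℝ≥0) (f : C(I, ℝ)) : X.TL t f = X.T t f := rfl

lemma T_add (s t : ℝ≥0) (f : C(I, ℝ)) : X.T (s + t) f = X.T s (X.T t f) := by
  ext x
  have := X.markov x s t f univ MeasurableSet.univ
  simpa [T] using this

lemma T_zero (f : C(I, ℝ)) : X.T 0 f = f := by
  ext x
  have := X.law_prob x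
  have h : (fun ω : PathSpace => f (ω.1 0)) =ᵐ[X.law x] fun _ => f x := by
    filter_upwards [X.law_start x] with ω hω
    rw [hω]
  simp only [T, ContinuousMap.coe_mk]
  rw [integral_congr_ae h]
  simp

lemma norm_T_sub_le (s t : ℝ≥0) (f : C(I, ℝ)) :
    ‖X.T (s + t) f - X.T s f‖ ≤ ‖X.T t f - f‖ := by
  have h : X.T (s + t) f - X.T s f = X.TL s (X.T t f - f) := by
    rw [map_sub, TL_apply, TL_apply, T_add]
  rw [h]
  exact X.norm_T_le s _

lemma norm_T_sub_le' (s t : ℝ≥0) (f : C(I, ℝ)) :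
    ‖X.T s f - X.T t f‖ ≤ ‖X.T (max s t - min s t) f - f‖ := by
  rcases le_total s t with h | h
  · have := X.norm_T_sub_le s (t - s) f
    rw [add_tsub_cancel_of_le h] at this
    rwa [max_eq_right h, min_eq_left h, norm_sub_rev]
  · have := X.norm_T_sub_le t (s - t) f
    rw [add_tsub_cancel_of_le h] at this
    rwa [max_eq_left h, min_eq_right h]

lemma tendsto_T_zero (f : C(I, ℝ)) : Tendsto (fun t => X.T t f) (𝓝 0) (𝓝 f) := by
  have h : Tendsto (fun t => X.T t f) (𝓝[>] 0) (𝓝 f) := X.strong_cont f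
  have h2 : Tendsto (fun t => X.T t f) (𝓝[≥] (0 : ℝ≥0)) (𝓝 f) := by
    have h3 : ContinuousWithinAt (fun t => X.T t f) (Ioi 0) 0 := by
      simpa only [ContinuousWithinAt, T_zero] using h
    simpa only [ContinuousWithinAt, T_zero] using continuousWithinAt_Ioi_iff_Ici.1 h3
  have h4 : Ici (0 : ℝ≥0) = univ := by ext; simp
  rwa [h4, nhdsWithin_univ] at h2

lemma continuous_T (f : C(I, ℝ)) : Continuous fun t => X.T t f := by
  rw [continuous_iff_continuousAt]
  intro t
  rw [ContinuousAt, tendsto_iff_norm_sub_tendsto_zero]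
  have h1 : Tendsto (fun s : ℝ≥0 => max s t - min s t) (𝓝 t) (𝓝 0) := by
    have : Continuous fun s : ℝ≥0 => max s t - min s t := by fun_prop
    simpa using this.tendsto t
  have h2 := ((X.tendsto_T_zero f).comp h1)
  rw [tendsto_iff_norm_sub_tendsto_zero] at h2
  exact squeeze_zero (fun _ => norm_nonneg _) (fun s => X.norm_T_sub_le' s t f) h2

variable {X}

lemma HasGen.sub {f g f' g' : C(I, ℝ)} (h : X.HasGen f g) (h' : X.HasGen f' g') :
    X.HasGen (f - f') (g - g') := by
  unfold HasGen at *
  convert Tendsto.sub h h' using 2 with t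
  rw [← smul_sub, ← TL_apply, map_sub, TL_apply, TL_apply]
  congr 1
  abel

/-- The generator is dissipative. -/
lemma HasGen.norm_le {f g : C(I, ℝ)} (h : X.HasGen f g) : ‖f‖ ≤ ‖f - g‖ := by
  have h1 : Tendsto (fun t : ℝ≥0 => ‖f - (t : ℝ)⁻¹ • (X.T t f - f)‖) (𝓝[>] 0) (𝓝 ‖f - g‖) :=
    (tendsto_const_nhds.sub h).norm
  refine ge_of_tendsto h1 ?_
  filter_upwards [self_mem_nhdsWithin] with t ht
  have ht' : (0 : ℝ) < t := ht
  have e : f - (t : ℝ)⁻¹ • (X.T t f - f) = (1 + (t : ℝ)⁻¹) • f - (t : ℝ)⁻¹ • X.T t f := by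
    module
  rw [e]
  have n1 : ‖(1 + (t : ℝ)⁻¹) • f‖ = (1 + (t : ℝ)⁻¹) * ‖f‖ := by
    rw [norm_smul, Real.norm_of_nonneg (by positivity)]
  have n2 : ‖(t : ℝ)⁻¹ • X.T t f‖ ≤ (t : ℝ)⁻¹ * ‖f‖ := by
    rw [norm_smul, Real.norm_of_nonneg (by positivity)]
    gcongr
    exact X.norm_T_le t f
  have := norm_sub_norm_le ((1 + (t : ℝ)⁻¹) • f) ((t : ℝ)⁻¹ • X.T t f)
  linarith

variable (X)

/-- The integrand `e^{-r} T_r h` of the resolvent at `1`, extended to negative times. -/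
def resKernel (h : C(I, ℝ)) (r : ℝ) : C(I, ℝ) := Real.exp (-r) • X.T r.toNNReal h

lemma continuous_resKernel (h : C(I, ℝ)) : Continuous (X.resKernel h) := by
  have h1 : Continuous fun r : ℝ => X.T r.toNNReal h :=
    (X.continuous_T h).comp continuous_real_toNNReal
  exact (Real.continuous_exp.comp continuous_neg).smul h1

lemma integrableOn_resKernel (h : C(I, ℝ)) (δ : ℝ) : IntegrableOn (X.resKernel h) (Ioi δ) := by
  have h1 : IntegrableOn (fun r : ℝ => Real.exp (-r) * ‖h‖) (Ioi δ) :=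
    (integrableOn_exp_neg_Ioi δ).mul_const _
  refine Integrable.mono' h1 (X.continuous_resKernel h).aestronglyMeasurable ?_
  refine Eventually.of_forall fun r => ?_
  rw [resKernel, norm_smul, Real.norm_of_nonneg (Real.exp_pos _).le]
  gcongr
  exact X.norm_T_le _ h

lemma T_resolvent (h : C(I, ℝ)) (t : ℝ≥0) :
    X.T t (∫ r in Ioi (0 : ℝ), X.resKernel h r)
      = Real.exp t • ∫ r in Ioi (t : ℝ), X.resKernel h r := by
  rw [← TL_apply, ← ContinuousLinearMap.integral_comp_comm _ (X.integrableOn_resKernel h 0),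
    ← integral_smul]
  have e : ∀ r ∈ Ioi (0 : ℝ), X.TL t (X.resKernel h r)
      = (fun r => Real.exp t • X.resKernel h r) (r + t) := by
    intro r hr
    have hr' : (0 : ℝ) ≤ r := le_of_lt hr
    simp only [resKernel, map_smul, TL_apply, smul_smul, ← Real.exp_add]
    have e1 : (r + (t : ℝ)).toNNReal = t + r.toNNReal := by
      rw [Real.toNNReal_add hr' t.coe_nonneg, Real.toNNReal_coe, add_comm]
    rw [← T_add, e1, neg_add, add_comm (-r), add_neg_cancel_left]
  rw [setIntegral_congr_fun measurableSet_Ioi e]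
  have := (measurePreserving_add_right volume (t : ℝ)).setIntegral_preimage_emb
    (measurableEmbedding_addRight (t : ℝ)) (fun r => Real.exp t • X.resKernel h r) (Ioi (t : ℝ))
  simpa using this

/-- The resolvent at `1` solves `f - A f = h` for every `h ∈ C[0, 1]`. -/
theorem exists_hasGen_sub_eq (h : C(I, ℝ)) : ∃ f g : C(I, ℝ), X.HasGen f g ∧ f - g = h := by
  set u : C(I, ℝ) := ∫ r in Ioi (0 : ℝ), X.resKernel h r with hu
  refine ⟨u, u - h, ?_, by abel⟩
  have hk0 : X.resKernel h 0 = h := by simp [resKernel, T_zero]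
  -- `δ ↦ e^δ ∫_δ^∞ e^{-r} T_r h dr` is differentiable, with derivative `u - h` at `0`.
  have hd : HasDerivAt (fun δ : ℝ => Real.exp δ • (u - ∫ r in (0 : ℝ)..δ, X.resKernel h r))
      (u - h) 0 := by
    have h1 : HasDerivAt (fun δ : ℝ => ∫ r in (0 : ℝ)..δ, X.resKernel h r) (X.resKernel h 0) 0 :=
      intervalIntegral.integral_hasDerivAt_right
        ((X.continuous_resKernel h).intervalIntegrable _ _)
        (X.continuous_resKernel h).stronglyMeasurable.stronglyMeasurableAtFilter
        (X.continuous_resKernel h).continuousAt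
    have h2 := (Real.hasDerivAt_exp 0).smul (h1.const_sub u)
    rw [hk0] at h2
    have e : u - h = Real.exp 0 • -h
        + Real.exp 0 • (u - ∫ r in (0 : ℝ)..0, X.resKernel h r) := by
      rw [intervalIntegral.integral_same, Real.exp_zero, one_smul, one_smul]
      abel
    rw [e]
    exact h2
  have ht := hd.tendsto_slope_zero_right
  have hc : Tendsto (fun t : ℝ≥0 => (t : ℝ)) (𝓝[>] 0) (𝓝[>] (0 : ℝ)) := by
    refine tendsto_nhdsWithin_of_tendsto_nhds_of_eventually_within _ ?_ ?_
    · exact (NNReal.continuous_coe.tendsto' 0 0 rfl).mono_left nhdsWithin_le_nhds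
    · filter_upwards [self_mem_nhdsWithin] with t ht
      exact_mod_cast ht
  unfold HasGen
  refine (ht.comp hc).congr fun t => ?_
  have e : u - ∫ r in (0 : ℝ)..(t : ℝ), X.resKernel h r
      = ∫ r in Ioi (t : ℝ), X.resKernel h r := by
    rw [hu, sub_eq_iff_eq_add, add_comm, intervalIntegral.integral_interval_add_Ioi]
    · exact X.integrableOn_resKernel h 0
    · exact X.integrableOn_resKernel h t
  simp only [Function.comp, zero_add]
  rw [e, ← T_resolvent]
  simp [hu]

end FellerProcess

/-! ### Calculus on the open unit interval -/

lemma realExt_coe (f : I → ℝ) (x : I) : realExt f x = f x := IccExtend_val _ _ _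

lemma realExt_of_mem (f : I → ℝ) {x : ℝ} (hx : x ∈ Icc (0 : ℝ) 1) : realExt f x = f ⟨x, hx⟩ :=
  IccExtend_of_mem _ _ hx

lemma continuous_realExt (f : C(I, ℝ)) : Continuous (realExt f) :=
  f.continuous.Icc_extend'

lemma abs_realExt_le (f : C(I, ℝ)) (x : ℝ) : |realExt f x| ≤ ‖f‖ := f.norm_coe_le_norm _

lemma realExt_sub (f g : C(I, ℝ)) : realExt ⇑(f - g) = realExt f - realExt g := rfl

lemma half_mem : (1 / 2 : ℝ) ∈ Ioo (0 : ℝ) 1 := by constructor <;> norm_num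

lemma uIcc_subset_unit {x y : ℝ} (hx : x ∈ Ioo (0 : ℝ) 1) (hy : y ∈ Ioo (0 : ℝ) 1) :
    uIcc x y ⊆ Ioo 0 1 := ordConnected_Ioo.uIcc_subset hx hy

lemma intervalIntegrable_of_continuousOn_unit {p : ℝ → ℝ} (hp : ContinuousOn p (Ioo 0 1)) {x y : ℝ}
    (hx : x ∈ Ioo (0 : ℝ) 1) (hy : y ∈ Ioo (0 : ℝ) 1) : IntervalIntegrable p volume x y :=
  (hp.mono (uIcc_subset_unit hx hy)).intervalIntegrable

lemma hasDerivAt_integral_of_continuousOn {p : ℝ → ℝ} (hp : ContinuousOn p (Ioo 0 1)) {c x : ℝ}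
    (hi : IntervalIntegrable p volume c x) (hx : x ∈ Ioo (0 : ℝ) 1) :
    HasDerivAt (fun x => ∫ y in c..x, p y) (p x) x :=
  intervalIntegral.integral_hasDerivAt_right hi
    (hp.stronglyMeasurableAtFilter isOpen_Ioo x hx) (hp.continuousAt (isOpen_Ioo.mem_nhds hx))

lemma hasDerivAt_of_contDiffOn {φ : ℝ → ℝ} (h : ContDiffOn ℝ 2 φ (Ioo 0 1)) {x : ℝ}
    (hx : x ∈ Ioo (0 : ℝ) 1) : HasDerivAt φ (deriv φ x) x :=
  ((h.differentiableOn (by norm_num)).differentiableAt (isOpen_Ioo.mem_nhds hx)).hasDerivAt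

lemma hasDerivAt_deriv_of_contDiffOn {φ : ℝ → ℝ} (h : ContDiffOn ℝ 2 φ (Ioo 0 1)) {x : ℝ}
    (hx : x ∈ Ioo (0 : ℝ) 1) : HasDerivAt (deriv φ) (deriv (deriv φ) x) x := by
  have h1 : ContDiffOn ℝ 1 (deriv φ) (Ioo 0 1) :=
    h.deriv_of_isOpen isOpen_Ioo (by norm_num)
  exact ((h1.differentiableOn (by norm_num)).differentiableAt (isOpen_Ioo.mem_nhds hx)).hasDerivAt

lemma lintegral_ofReal_lt_top_of_le {A : Set ℝ} (hA : MeasurableSet A) {g h : ℝ → ℝ}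
    (hg : IntegrableOn g A) (hle : ∀ y ∈ A, h y ≤ g y) :
    ∫⁻ y in A, ENNReal.ofReal (h y) < ∞ := by
  refine lt_of_le_of_lt (setLIntegral_mono_ae' hA (Eventually.of_forall fun y hy =>
    ENNReal.ofReal_le_ofReal ((hle y hy).trans (le_abs_self _)))) ?_
  exact hg.norm.lintegral_lt_top

lemma integrableOn_of_lintegral_ofReal {A : Set ℝ} (hA : MeasurableSet A) {q h : ℝ → ℝ} {c : ℝ}
    (hc : 0 < c) (hq : ContinuousOn q A) (hq0 : ∀ y ∈ A, 0 ≤ q y) (hle : ∀ y ∈ A, c * q y ≤ h y)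
    (hfin : ∫⁻ y in A, ENNReal.ofReal (h y) < ∞) : IntegrableOn q A := by
  have h1 : IntegrableOn (fun y => c * q y) A := by
    refine ⟨(hq.const_smul c).aestronglyMeasurable hA, ?_⟩
    rw [hasFiniteIntegral_iff_ofReal]
    · exact lt_of_le_of_lt (setLIntegral_mono_ae' hA (Eventually.of_forall fun y hy =>
        ENNReal.ofReal_le_ofReal (hle y hy))) hfin
    · filter_upwards [ae_restrict_mem hA] with y hy
      exact mul_nonneg hc.le (hq0 y hy)
  have h2 := h1.const_mul c⁻¹
  refine (integrableOn_congr_fun (fun y _ => ?_) hA).1 h2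
  show c⁻¹ * (c * q y) = q y
  field_simp

/-- Finiteness of a double integral of the kind that defines `N(0)` and `Σ(0)` makes the outer
density integrable at `0`. -/
lemma integrableOn_left_of_lintegral {p q : ℝ → ℝ} (hp : ContinuousOn p (Ioo 0 1))
    (hq : ContinuousOn q (Ioo 0 1)) (hp0 : ∀ x ∈ Ioo (0 : ℝ) 1, 0 < p x)
    (hq0 : ∀ x ∈ Ioo (0 : ℝ) 1, 0 < q x)
    (h : ∫⁻ y in Ioc (0 : ℝ) (1 / 2), ENNReal.ofReal
      (((∫ t in (1 / 2 : ℝ)..(1 / 2), p t) - ∫ t in (1 / 2 : ℝ)..y, p t) * q y) < ∞) :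
    IntegrableOn q (Ioc 0 (1 / 2)) := by
  have h4 : (1 / 4 : ℝ) ∈ Ioo (0 : ℝ) 1 := by constructor <;> norm_num
  have i1 : IntegrableOn q (Icc (1 / 4) (1 / 2)) :=
    (hq.mono (Icc_subset_Ioo h4.1 half_mem.2)).integrableOn_Icc
  have i2 : IntegrableOn q (Ioc 0 (1 / 4)) := by
    have hsub : Ioc (0 : ℝ) (1 / 4) ⊆ Ioo 0 1 := Ioc_subset_Ioo_right h4.2
    have hc : 0 < ∫ t in (1 / 4 : ℝ)..(1 / 2), p t :=
      intervalIntegral.intervalIntegral_pos_of_pos_on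
        (intervalIntegrable_of_continuousOn_unit hp h4 half_mem)
        (fun x hx => hp0 x ⟨h4.1.trans hx.1, hx.2.trans half_mem.2⟩) (by norm_num)
    refine integrableOn_of_lintegral_ofReal measurableSet_Ioc hc (hq.mono hsub)
      (fun y hy => (hq0 y (hsub hy)).le) (fun y hy => ?_) (lt_of_le_of_lt
        (lintegral_mono_set (Ioc_subset_Ioc_right (by norm_num : (1 / 4 : ℝ) ≤ 1 / 2))) h)
    refine mul_le_mul_of_nonneg_right ?_ (hq0 y (hsub hy)).le
    rw [intervalIntegral.integral_same, zero_sub, ← intervalIntegral.integral_symm,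
      ← intervalIntegral.integral_add_adjacent_intervals
        (intervalIntegrable_of_continuousOn_unit hp (hsub hy) h4)
        (intervalIntegrable_of_continuousOn_unit hp h4 half_mem)]
    have : 0 ≤ ∫ t in y..(1 / 4 : ℝ), p t := intervalIntegral.integral_nonneg hy.2
      fun t ht => (hp0 t ⟨hy.1.trans_le ht.1, ht.2.trans_lt h4.2⟩).le
    linarith
  refine (i2.union i1).mono_set fun y hy => ?_
  rcases le_total y (1 / 4) with hle | hle
  · exact Or.inl ⟨hy.1, hle⟩
  · exact Or.inr ⟨hle, hy.2⟩

/-- The analogue of `integrableOn_left_of_lintegral` at the boundary point `1`. -/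
lemma integrableOn_right_of_lintegral {p q : ℝ → ℝ} (hp : ContinuousOn p (Ioo 0 1))
    (hq : ContinuousOn q (Ioo 0 1)) (hp0 : ∀ x ∈ Ioo (0 : ℝ) 1, 0 < p x)
    (hq0 : ∀ x ∈ Ioo (0 : ℝ) 1, 0 < q x)
    (h : ∫⁻ y in Ico (1 / 2 : ℝ) 1, ENNReal.ofReal
      (((∫ t in (1 / 2 : ℝ)..y, p t) - ∫ t in (1 / 2 : ℝ)..(1 / 2), p t) * q y) < ∞) :
    IntegrableOn q (Ico (1 / 2) 1) := by
  have h4 : (3 / 4 : ℝ) ∈ Ioo (0 : ℝ) 1 := by constructor <;> norm_num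
  have i1 : IntegrableOn q (Icc (1 / 2) (3 / 4)) :=
    (hq.mono (Icc_subset_Ioo half_mem.1 h4.2)).integrableOn_Icc
  have i2 : IntegrableOn q (Ico (3 / 4) 1) := by
    have hsub : Ico (3 / 4 : ℝ) 1 ⊆ Ioo 0 1 := Ico_subset_Ioo_left h4.1
    have hc : 0 < ∫ t in (1 / 2 : ℝ)..(3 / 4), p t :=
      intervalIntegral.intervalIntegral_pos_of_pos_on
        (intervalIntegrable_of_continuousOn_unit hp half_mem h4)
        (fun x hx => hp0 x ⟨half_mem.1.trans hx.1, hx.2.trans h4.2⟩) (by norm_num)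
    refine integrableOn_of_lintegral_ofReal measurableSet_Ico hc (hq.mono hsub)
      (fun y hy => (hq0 y (hsub hy)).le) (fun y hy => ?_) (lt_of_le_of_lt
        (lintegral_mono_set (Ico_subset_Ico_left (by norm_num : (1 / 2 : ℝ) ≤ 3 / 4))) h)
    refine mul_le_mul_of_nonneg_right ?_ (hq0 y (hsub hy)).le
    rw [intervalIntegral.integral_same, sub_zero,
      ← intervalIntegral.integral_add_adjacent_intervals
        (intervalIntegrable_of_continuousOn_unit hp half_mem h4)
        (intervalIntegrable_of_continuousOn_unit hp h4 (hsub hy))]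
    have : 0 ≤ ∫ t in (3 / 4 : ℝ)..y, p t := intervalIntegral.integral_nonneg hy.1
      fun t ht => (hp0 t ⟨h4.1.trans_le ht.1, ht.2.trans_lt hy.2⟩).le
    linarith
  refine (i1.union i2).mono_set fun y hy => ?_
  rcases le_total y (3 / 4) with hle | hle
  · exact Or.inl ⟨hy.1, hle⟩
  · exact Or.inr ⟨hle, hy.2⟩

/-- If `u` is continuous at `0` and `u' / s` has a nonzero limit there, then `s` is integrable
at `0`. -/
lemma integrableOn_left_of_flux {u s : ℝ → ℝ} (hu : Continuous u)
    (hd : ∀ x ∈ Ioo (0 : ℝ) 1, HasDerivAt u (deriv u x) x) (hs : ContinuousOn s (Ioo 0 1))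
    (hs0 : ∀ x ∈ Ioo (0 : ℝ) 1, 0 < s x) {L : ℝ} (hL : L ≠ 0)
    (h : Tendsto (fun x => deriv u x / s x) (𝓝[>] 0) (𝓝 L)) : IntegrableOn s (Ioc 0 (1 / 2)) := by
  -- Multiplication by `L` makes the limit positive whatever the sign of `L`.
  have h1 : Tendsto (fun x => L * (deriv u x / s x)) (𝓝[>] 0) (𝓝 (L * L)) := h.const_mul L
  have hLL : 0 < L * L := mul_self_pos.2 hL
  have h2 := h1.eventually (eventually_gt_nhds (half_lt_self hLL))
  obtain ⟨δ, hδ, hδ'⟩ := mem_nhdsGT_iff_exists_Ioo_subset.1 h2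
  set ε := min δ (1 / 2) with hε
  have hε0 : 0 < ε := lt_min hδ (by norm_num)
  have hε1 : ε ≤ 1 / 2 := min_le_right _ _
  have hsub : Ioo 0 ε ⊆ Ioo (0 : ℝ) 1 := Ioo_subset_Ioo_right (by linarith)
  have hlow : ∀ x ∈ Ioo 0 ε, L * L / 2 * s x ≤ L * deriv u x := by
    intro x hx
    have hx' : L * L / 2 < L * (deriv u x / s x) := hδ' ⟨hx.1, hx.2.trans_le (min_le_left _ _)⟩
    have := hs0 x (hsub hx)
    rw [← mul_div_assoc, lt_div_iff₀ this] at hx'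
    exact hx'.le
  have i1 : IntegrableOn (fun x => L * deriv u x) (Ioc 0 ε) := by
    refine intervalIntegral.integrableOn_deriv_of_nonneg (g := fun x => L * u x)
      (continuous_const.mul hu).continuousOn
      (fun x hx => (hd x (hsub hx)).const_mul L) (fun x hx => ?_)
    exact (mul_nonneg (by positivity) (hs0 x (hsub hx)).le).trans (hlow x hx)
  have i2 : IntegrableOn s (Ioo 0 ε) := by
    refine integrableOn_of_lintegral_ofReal measurableSet_Ioo (half_pos hLL) (hs.mono hsub)
      (fun y hy => (hs0 y (hsub hy)).le) hlow
      (lintegral_ofReal_lt_top_of_le measurableSet_Ioo (i1.mono_set Ioo_subset_Ioc_self)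
        fun _ _ => le_rfl)
  have i3 : IntegrableOn s (Icc ε (1 / 2)) :=
    (hs.mono (Icc_subset_Ioo hε0 half_mem.2)).integrableOn_Icc
  refine (i2.union i3).mono_set fun y hy => ?_
  rcases lt_or_ge y ε with hle | hle
  · exact Or.inl ⟨hy.1, hle⟩
  · exact Or.inr ⟨hle, hy.2⟩

/-- If `u` is continuous at `1` and `u' / s` has a nonzero limit there, then `s` is integrable
at `1`. -/
lemma integrableOn_right_of_flux {u s : ℝ → ℝ} (hu : Continuous u)
    (hd : ∀ x ∈ Ioo (0 : ℝ) 1, HasDerivAt u (deriv u x) x) (hs : ContinuousOn s (Ioo 0 1))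
    (hs0 : ∀ x ∈ Ioo (0 : ℝ) 1, 0 < s x) {L : ℝ} (hL : L ≠ 0)
    (h : Tendsto (fun x => deriv u x / s x) (𝓝[<] 1) (𝓝 L)) : IntegrableOn s (Ico (1 / 2) 1) := by
  -- Multiplication by `L` makes the limit positive whatever the sign of `L`.
  have h1 : Tendsto (fun x => L * (deriv u x / s x)) (𝓝[<] 1) (𝓝 (L * L)) := h.const_mul L
  have hLL : 0 < L * L := mul_self_pos.2 hL
  have h2 := h1.eventually (eventually_gt_nhds (half_lt_self hLL))
  obtain ⟨δ, hδ, hδ'⟩ := mem_nhdsLT_iff_exists_Ioo_subset.1 h2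
  set ε := max δ (1 / 2) with hε
  have hε0 : ε < 1 := max_lt hδ (by norm_num)
  have hε1 : 1 / 2 ≤ ε := le_max_right _ _
  have hsub : Ioo ε 1 ⊆ Ioo (0 : ℝ) 1 := Ioo_subset_Ioo_left (by linarith)
  have hlow : ∀ x ∈ Ioo ε 1, L * L / 2 * s x ≤ L * deriv u x := by
    intro x hx
    have hx' : L * L / 2 < L * (deriv u x / s x) := hδ' ⟨(le_max_left _ _).trans_lt hx.1, hx.2⟩
    have := hs0 x (hsub hx)
    rw [← mul_div_assoc, lt_div_iff₀ this] at hx'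
    exact hx'.le
  have i1 : IntegrableOn (fun x => L * deriv u x) (Ioc ε 1) := by
    refine intervalIntegral.integrableOn_deriv_of_nonneg (g := fun x => L * u x)
      (continuous_const.mul hu).continuousOn
      (fun x hx => (hd x (hsub hx)).const_mul L) (fun x hx => ?_)
    exact (mul_nonneg (by positivity) (hs0 x (hsub hx)).le).trans (hlow x hx)
  have i2 : IntegrableOn s (Ioo ε 1) := by
    refine integrableOn_of_lintegral_ofReal measurableSet_Ioo (half_pos hLL) (hs.mono hsub)
      (fun y hy => (hs0 y (hsub hy)).le) hlow
      (lintegral_ofReal_lt_top_of_le measurableSet_Ioo (i1.mono_set Ioo_subset_Ioc_self)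
        fun _ _ => le_rfl)
  have i3 : IntegrableOn s (Icc (1 / 2) ε) :=
    (hs.mono (Icc_subset_Ioo half_mem.1 hε0)).integrableOn_Icc
  refine (i3.union i2).mono_set fun y hy => ?_
  rcases le_or_gt y ε with hle | hle
  · exact Or.inl ⟨hy.1, hle⟩
  · exact Or.inr ⟨hle, hy.2⟩

namespace FellerDiffusion

/-! ### Scale and speed -/

variable (X : FellerDiffusion)

lemma continuousOn_drift : ContinuousOn (fun y => 2 * X.a y / X.b y) (Ioo 0 1) :=
  (X.a_cont.const_smul (2 : ℝ)).div X.b_cont fun x hx => (X.b_pos x hx).ne'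

lemma s_pos (x : ℝ) : 0 < X.s x := Real.exp_pos _

lemma s_half : X.s (1 / 2) = 1 := by simp [s]

lemma hasDerivAt_s {x : ℝ} (hx : x ∈ Ioo (0 : ℝ) 1) :
    HasDerivAt X.s (-(2 * X.a x / X.b x) * X.s x) x := by
  have h := (hasDerivAt_integral_of_continuousOn X.continuousOn_drift
    (intervalIntegrable_of_continuousOn_unit X.continuousOn_drift half_mem hx) hx).fun_neg.exp
  rw [mul_comm] at h
  exact h

lemma continuousOn_s : ContinuousOn X.s (Ioo 0 1) :=
  fun _ hx => (X.hasDerivAt_s hx).continuousAt.continuousWithinAt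

lemma m_pos {x : ℝ} (hx : x ∈ Ioo (0 : ℝ) 1) : 0 < X.m x :=
  inv_pos.2 (mul_pos (X.s_pos x) (X.b_pos x hx))

lemma continuousOn_m : ContinuousOn X.m (Ioo 0 1) :=
  (X.continuousOn_s.mul X.b_cont).inv₀ fun x hx => (mul_pos (X.s_pos x) (X.b_pos x hx)).ne'

lemma integrableOn_m_left (h : X.N0 < ∞) : IntegrableOn X.m (Ioc 0 (1 / 2)) :=
  integrableOn_left_of_lintegral X.continuousOn_s X.continuousOn_m (fun x _ => X.s_pos x)
    (fun _ hx => X.m_pos hx) h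

lemma integrableOn_m_right (h : X.N1 < ∞) : IntegrableOn X.m (Ico (1 / 2) 1) :=
  integrableOn_right_of_lintegral X.continuousOn_s X.continuousOn_m (fun x _ => X.s_pos x)
    (fun _ hx => X.m_pos hx) h

lemma intervalIntegrable_m (h0 : X.N0 < ∞) (h1 : X.N1 < ∞) : IntervalIntegrable X.m volume 0 1 := by
  rw [intervalIntegrable_iff_integrableOn_Ioo_of_le zero_le_one]
  refine ((X.integrableOn_m_left h0).union (X.integrableOn_m_right h1)).mono_set fun y hy => ?_
  rcases le_total y (1 / 2) with h | h
  · exact Or.inl ⟨hy.1, h⟩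
  · exact Or.inr ⟨h, hy.2⟩

variable {X}

lemma Entrance0.not_integrableOn_s (h : X.Entrance0) : ¬ IntegrableOn X.s (Ioc 0 (1 / 2)) := by
  intro hs
  have hm := X.integrableOn_m_left h.1
  refine (lintegral_ofReal_lt_top_of_le measurableSet_Ioc
    (hs.const_mul (∫ t in Ioc (0 : ℝ) (1 / 2), X.m t)) fun y hy => ?_).ne h.2
  refine mul_le_mul_of_nonneg_right ?_ (X.s_pos y).le
  rw [M, M, intervalIntegral.integral_same, zero_sub, ← intervalIntegral.integral_symm,
    intervalIntegral.integral_of_le hy.2]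
  refine setIntegral_mono_set hm ?_ (Ioc_subset_Ioc_left hy.1.le).eventuallyLE
  filter_upwards [ae_restrict_mem measurableSet_Ioc] with t ht
  exact (X.m_pos ⟨ht.1, ht.2.trans_lt half_mem.2⟩).le

lemma Entrance1.not_integrableOn_s (h : X.Entrance1) : ¬ IntegrableOn X.s (Ico (1 / 2) 1) := by
  intro hs
  have hm := X.integrableOn_m_right h.1
  refine (lintegral_ofReal_lt_top_of_le measurableSet_Ico
    (hs.const_mul (∫ t in Ico (1 / 2 : ℝ) 1, X.m t)) fun y hy => ?_).ne h.2
  refine mul_le_mul_of_nonneg_right ?_ (X.s_pos y).le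
  rw [M, M, intervalIntegral.integral_same, sub_zero, intervalIntegral.integral_of_le hy.1,
    integral_Ioc_eq_integral_Ioo]
  refine setIntegral_mono_set hm ?_
    (Ioo_subset_Ico_self.trans (Ico_subset_Ico_right hy.2.le)).eventuallyLE
  filter_upwards [ae_restrict_mem measurableSet_Ico] with t ht
  exact (X.m_pos ⟨half_mem.1.trans_le ht.1, ht.2⟩).le

/-! ### The generator as a differential operator, and the flux at the boundary -/

variable (X) in
/-- `g` is the image of `f` under the differential operator `(1/2) b d²/dx² + a d/dx` on the open
interval, no boundary condition being imposed. -/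
def InteriorGen (f g : C(I, ℝ)) : Prop :=
  ContDiffOn ℝ 2 (realExt f) (Ioo 0 1) ∧ ∀ x ∈ Ioo (0 : ℝ) 1,
    realExt g x = 1 / 2 * X.b x * deriv (deriv (realExt f)) x + X.a x * deriv (realExt f) x

lemma interiorGen_of_hasGen {f g : C(I, ℝ)} (h : X.HasGen f g) : X.InteriorGen f g := by
  refine ⟨X.dom_C2 f g h, fun x hx => ?_⟩
  rw [realExt_of_mem _ (Ioo_subset_Icc_self hx)]
  exact X.gen_eq f g h ⟨x, _⟩ hx

variable (X) in
/-- The flux `df/dS = f' / s`. -/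
def flux (f : C(I, ℝ)) (x : ℝ) : ℝ := deriv (realExt f) x / X.s x

lemma deriv_realExt_sub {f f' : C(I, ℝ)} (h : ContDiffOn ℝ 2 (realExt f) (Ioo 0 1))
    (h' : ContDiffOn ℝ 2 (realExt f') (Ioo 0 1)) {x : ℝ} (hx : x ∈ Ioo (0 : ℝ) 1) :
    deriv (realExt ⇑(f - f')) x = deriv (realExt f) x - deriv (realExt f') x := by
  rw [realExt_sub]
  exact ((hasDerivAt_of_contDiffOn h hx).sub (hasDerivAt_of_contDiffOn h' hx)).deriv

lemma InteriorGen.sub {f g f' g' : C(I, ℝ)} (h : X.InteriorGen f g) (h' : X.InteriorGen f' g') :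
    X.InteriorGen (f - f') (g - g') := by
  refine ⟨h.1.sub h'.1, fun x hx => ?_⟩
  have e : deriv (realExt ⇑(f - f')) =ᶠ[𝓝 x] fun y => deriv (realExt f) y - deriv (realExt f') y :=
    Filter.eventually_of_mem (isOpen_Ioo.mem_nhds hx) fun y hy => deriv_realExt_sub h.1 h'.1 hy
  rw [e.deriv_eq, e.eq_of_nhds, ((hasDerivAt_deriv_of_contDiffOn h.1 hx).fun_sub
    (hasDerivAt_deriv_of_contDiffOn h'.1 hx)).deriv, realExt_sub, Pi.sub_apply, h.2 x hx, h'.2 x hx]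
  ring

/-- The generator in divergence form: `d(df/dS)/dM = 2 A f`. -/
lemma InteriorGen.hasDerivAt_flux {f g : C(I, ℝ)} (h : X.InteriorGen f g) {x : ℝ}
    (hx : x ∈ Ioo (0 : ℝ) 1) : HasDerivAt (X.flux f) (2 * (X.m x * realExt g x)) x := by
  have h1 := (hasDerivAt_deriv_of_contDiffOn h.1 hx).fun_div (X.hasDerivAt_s hx) (X.s_pos x).ne'
  refine h1.congr_deriv ?_
  have hb := (X.b_pos x hx).ne'
  have hs := (X.s_pos x).ne'
  rw [h.2 x hx, m]
  field_simp
  ring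

lemma intervalIntegrable_m_mul (hm : IntervalIntegrable X.m volume 0 1) (g : C(I, ℝ)) {x y : ℝ}
    (hx : x ∈ Icc (0 : ℝ) 1) (hy : y ∈ Icc (0 : ℝ) 1) :
    IntervalIntegrable (fun y => X.m y * realExt g y) volume x y := by
  refine (hm.mono_set ?_).mul_continuousOn (continuous_realExt g).continuousOn
  rw [uIcc_of_le zero_le_one]
  exact ordConnected_Icc.uIcc_subset hx hy

/-- If the speed measure is finite, then the flux differs from `2 ∫_0^x g dM` by a constant. -/
lemma InteriorGen.flux_eq {f g : C(I, ℝ)} (h : X.InteriorGen f g)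
    (hm : IntervalIntegrable X.m volume 0 1) : ∃ L : ℝ, ∀ x ∈ Ioo (0 : ℝ) 1,
      X.flux f x = L + 2 * ∫ y in (0 : ℝ)..x, X.m y * realExt g y := by
  refine ⟨X.flux f (1 / 2) - 2 * ∫ y in (0 : ℝ)..(1 / 2), X.m y * realExt g y, fun x hx => ?_⟩
  have h1 := intervalIntegral.integral_eq_sub_of_hasDerivAt (a := 1 / 2) (b := x)
    (fun y hy => h.hasDerivAt_flux (uIcc_subset_unit half_mem hx hy))
    ((intervalIntegrable_m_mul hm g (Ioo_subset_Icc_self half_mem)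
      (Ioo_subset_Icc_self hx)).const_mul 2)
  rw [intervalIntegral.integral_const_mul] at h1
  have h2 := intervalIntegral.integral_add_adjacent_intervals
    (intervalIntegrable_m_mul hm g (left_mem_Icc.2 zero_le_one) (Ioo_subset_Icc_self half_mem))
    (intervalIntegrable_m_mul hm g (Ioo_subset_Icc_self half_mem) (Ioo_subset_Icc_self hx))
  linarith

lemma continuousOn_integral_m_mul (hm : IntervalIntegrable X.m volume 0 1) (g : C(I, ℝ)) :
    ContinuousOn (fun x => ∫ y in (0 : ℝ)..x, X.m y * realExt g y) (Icc 0 1) := by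
  have := intervalIntegral.continuousOn_primitive_interval' (intervalIntegrable_m_mul hm g
    (left_mem_Icc.2 zero_le_one) (right_mem_Icc.2 zero_le_one)) left_mem_uIcc
  rwa [uIcc_of_le zero_le_one] at this

lemma InteriorGen.exists_flux_limits {f g : C(I, ℝ)} (h : X.InteriorGen f g)
    (hm : IntervalIntegrable X.m volume 0 1) : ∃ L : ℝ,
      (∀ x ∈ Ioo (0 : ℝ) 1, X.flux f x = L + 2 * ∫ y in (0 : ℝ)..x, X.m y * realExt g y) ∧
      Tendsto (X.flux f) (𝓝[>] 0) (𝓝 L) ∧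
      Tendsto (X.flux f) (𝓝[<] 1) (𝓝 (L + 2 * ∫ y in (0 : ℝ)..1, X.m y * realExt g y)) := by
  obtain ⟨L, hL⟩ := h.flux_eq hm
  have hc : ContinuousOn (fun x => L + 2 * ∫ y in (0 : ℝ)..x, X.m y * realExt g y) (Icc 0 1) :=
    continuousOn_const.add (continuousOn_const.mul (continuousOn_integral_m_mul hm g))
  refine ⟨L, hL, ?_, ?_⟩
  · have h0 := (hc 0 (left_mem_Icc.2 zero_le_one)).mono Ioo_subset_Icc_self
    rw [ContinuousWithinAt, nhdsWithin_Ioo_eq_nhdsGT zero_lt_one] at h0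
    rw [intervalIntegral.integral_same, mul_zero, add_zero] at h0
    refine h0.congr' ?_
    filter_upwards [Ioo_mem_nhdsGT zero_lt_one] with x hx using (hL x hx).symm
  · have h0 := (hc 1 (right_mem_Icc.2 zero_le_one)).mono Ioo_subset_Icc_self
    rw [ContinuousWithinAt, nhdsWithin_Ioo_eq_nhdsLT zero_lt_one] at h0
    refine h0.congr' ?_
    filter_upwards [Ioo_mem_nhdsLT zero_lt_one] with x hx using (hL x hx).symm

variable (X) in
/-- Both boundary points are reflecting or entrance. -/
def ReflectingOrEntrance : Prop :=
  (X.Reflecting0 ∨ X.Entrance0) ∧ (X.Reflecting1 ∨ X.Entrance1)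

lemma ReflectingOrEntrance.N0_lt_top (hX : X.ReflectingOrEntrance) : X.N0 < ∞ :=
  hX.1.elim (fun h => h.1.1) fun h => h.1

lemma ReflectingOrEntrance.N1_lt_top (hX : X.ReflectingOrEntrance) : X.N1 < ∞ :=
  hX.2.elim (fun h => h.1.1) fun h => h.1

lemma ReflectingOrEntrance.intervalIntegrable_m (hX : X.ReflectingOrEntrance) :
    IntervalIntegrable X.m volume 0 1 :=
  X.intervalIntegrable_m hX.N0_lt_top hX.N1_lt_top

/-- The flux of every function in the domain vanishes at both boundary points: by definition at a
reflecting one, and at an entrance one because `s` is not integrable there. -/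
lemma ReflectingOrEntrance.tendsto_flux (hX : X.ReflectingOrEntrance) {f g : C(I, ℝ)}
    (h : X.HasGen f g) :
    Tendsto (X.flux f) (𝓝[>] 0) (𝓝 0) ∧ Tendsto (X.flux f) (𝓝[<] 1) (𝓝 0) := by
  have hi := interiorGen_of_hasGen h
  obtain ⟨L, -, h0, h1⟩ := hi.exists_flux_limits hX.intervalIntegrable_m
  constructor
  · rcases hX.1 with hr | he
    · exact hr.2 f ⟨g, h⟩
    · by_cases hL : L = 0
      · rwa [hL] at h0
      · exact absurd (integrableOn_left_of_flux (continuous_realExt f)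
          (fun x hx => hasDerivAt_of_contDiffOn hi.1 hx) X.continuousOn_s (fun x _ => X.s_pos x)
          hL h0) he.not_integrableOn_s
  · rcases hX.2 with hr | he
    · exact hr.2 f ⟨g, h⟩
    · by_cases hL : L + 2 * ∫ y in (0 : ℝ)..1, X.m y * realExt g y = 0
      · rwa [hL] at h1
      · exact absurd (integrableOn_right_of_flux (continuous_realExt f)
          (fun x hx => hasDerivAt_of_contDiffOn hi.1 hx) X.continuousOn_s (fun x _ => X.s_pos x)
          hL h1) he.not_integrableOn_s

lemma ReflectingOrEntrance.flux_eq (hX : X.ReflectingOrEntrance) {f g : C(I, ℝ)}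
    (h : X.HasGen f g) {x : ℝ} (hx : x ∈ Ioo (0 : ℝ) 1) :
    X.flux f x = 2 * ∫ y in (0 : ℝ)..x, X.m y * realExt g y := by
  obtain ⟨L, hL, h0, -⟩ := (interiorGen_of_hasGen h).exists_flux_limits hX.intervalIntegrable_m
  rw [hL x hx, tendsto_nhds_unique h0 (hX.tendsto_flux h).1, zero_add]

/-- Stationarity of the speed measure. -/
lemma ReflectingOrEntrance.integral_m_mul_eq_zero (hX : X.ReflectingOrEntrance) {f g : C(I, ℝ)}
    (h : X.HasGen f g) : ∫ y in (0 : ℝ)..1, X.m y * realExt g y = 0 := by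
  obtain ⟨L, -, h0, h1⟩ := (interiorGen_of_hasGen h).exists_flux_limits hX.intervalIntegrable_m
  have e0 := tendsto_nhds_unique h0 (hX.tendsto_flux h).1
  have e1 := tendsto_nhds_unique h1 (hX.tendsto_flux h).2
  linarith

/-! ### The domain of the generator -/

lemma eq_of_eqOn_interior {f g : C(I, ℝ)} (h : ∀ x ∈ Ioo (0 : ℝ) 1, realExt f x = realExt g x) :
    f = g := by
  have hc : EqOn (realExt f) (realExt g) (closure (Ioo 0 1)) :=
    EqOn.closure h (continuous_realExt f) (continuous_realExt g)
  rw [closure_Ioo zero_ne_one] at hc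
  ext x
  rw [← realExt_coe f x, ← realExt_coe g x]
  exact hc x.2

/-- Uniqueness for `u = A u` with vanishing flux at the boundary. The function `u · du/dS` is
nondecreasing and vanishes at both ends, hence is `0`. -/
lemma InteriorGen.eq_zero {u : C(I, ℝ)} (h : X.InteriorGen u u)
    (h0 : Tendsto (X.flux u) (𝓝[>] 0) (𝓝 0)) (h1 : Tendsto (X.flux u) (𝓝[<] 1) (𝓝 0)) :
    u = 0 := by
  set w : ℝ → ℝ := fun x => realExt u x * X.flux u x with hw
  have hd : ∀ x ∈ Ioo (0 : ℝ) 1, HasDerivAt w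
      (deriv (realExt u) x * X.flux u x + realExt u x * (2 * (X.m x * realExt u x))) x :=
    fun x hx => (hasDerivAt_of_contDiffOn h.1 hx).mul (h.hasDerivAt_flux hx)
  have e1 : ∀ x, 0 ≤ deriv (realExt u) x * X.flux u x := fun x => by
    rw [flux, ← mul_div_assoc]
    exact div_nonneg (mul_self_nonneg _) (X.s_pos x).le
  have hmono : MonotoneOn w (Ioo 0 1) := by
    refine monotoneOn_of_deriv_nonneg (convex_Ioo 0 1)
      (fun x hx => (hd x hx).continuousAt.continuousWithinAt) (fun x hx => ?_) fun x hx => ?_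
    · rw [interior_Ioo] at hx
      exact (hd x hx).differentiableAt.differentiableWithinAt
    · rw [interior_Ioo] at hx
      rw [(hd x hx).deriv]
      have : 0 ≤ realExt u x * (2 * (X.m x * realExt u x)) := by
        have := mul_nonneg (X.m_pos hx).le (mul_self_nonneg (realExt u x))
        linarith
      linarith [e1 x]
  have hbd : ∀ l : Filter ℝ, Tendsto (X.flux u) l (𝓝 0) → Tendsto w l (𝓝 0) := by
    intro l hl
    refine bdd_le_mul_tendsto_zero' ‖u‖ (Eventually.of_forall fun x => abs_realExt_le u x) hl
  have hz : ∀ x ∈ Ioo (0 : ℝ) 1, w x = 0 := by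
    intro x hx
    apply le_antisymm
    · refine ge_of_tendsto (hbd _ h1) ?_
      filter_upwards [Ioo_mem_nhdsLT hx.2] with y hy
      exact hmono hx ⟨hx.1.trans hy.1, hy.2⟩ hy.1.le
    · refine le_of_tendsto (hbd _ h0) ?_
      filter_upwards [Ioo_mem_nhdsGT hx.1] with y hy
      exact hmono ⟨hy.1, hy.2.trans hx.2⟩ hx hy.2.le
  refine eq_of_eqOn_interior fun x hx => ?_
  have hw0 : w =ᶠ[𝓝 x] fun _ => 0 := Filter.eventually_of_mem (isOpen_Ioo.mem_nhds hx) hz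
  have h2 := hw0.deriv_eq
  rw [(hd x hx).deriv, deriv_const] at h2
  have h3 : realExt u x * (2 * (X.m x * realExt u x)) ≤ 0 := by linarith [e1 x]
  have h4 : X.m x * (realExt u x * realExt u x) ≤ 0 := by linarith
  have h5 : realExt u x * realExt u x ≤ 0 := by
    by_contra hcon
    exact absurd h4 (not_le.2 (mul_pos (X.m_pos hx) (not_le.1 hcon)))
  have h6 : realExt u x = 0 := mul_self_eq_zero.1 (le_antisymm h5 (mul_self_nonneg _))
  rw [h6]
  rfl

/-- The domain of the generator is as large as the boundary conditions permit: by the resolvent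
`f - g` equals `f' - g'` with `g' = A f'`, and `f = f'` by uniqueness. -/
lemma ReflectingOrEntrance.hasGen_of_interiorGen (hX : X.ReflectingOrEntrance) {f g : C(I, ℝ)}
    (h : X.InteriorGen f g) (h0 : Tendsto (X.flux f) (𝓝[>] 0) (𝓝 0))
    (h1 : Tendsto (X.flux f) (𝓝[<] 1) (𝓝 0)) : X.HasGen f g := by
  obtain ⟨f', g', h', e⟩ := X.exists_hasGen_sub_eq (f - g)
  have hi' := interiorGen_of_hasGen h'
  have eg : g - g' = f - f' := by linear_combination e
  have hs := h.sub hi'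
  rw [eg] at hs
  have hfl : ∀ l : Filter ℝ, Ioo (0 : ℝ) 1 ∈ l → Tendsto (X.flux f) l (𝓝 0) →
      Tendsto (X.flux f') l (𝓝 0) → Tendsto (X.flux (f - f')) l (𝓝 0) := by
    intro l hl t t'
    have := t.sub t'
    rw [sub_zero] at this
    refine this.congr' ?_
    filter_upwards [hl] with x hx
    simp only [flux]
    rw [deriv_realExt_sub h.1 hi'.1 hx, sub_div]
  have hz := hs.eq_zero (hfl _ (Ioo_mem_nhdsGT zero_lt_one) h0 (hX.tendsto_flux h').1)
    (hfl _ (Ioo_mem_nhdsLT zero_lt_one) h1 (hX.tendsto_flux h').2)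
  have ef : f = f' := sub_eq_zero.1 hz
  have eg' : g = g' := sub_eq_zero.1 (eg.trans hz)
  rwa [ef, eg']

/-! ### The stationary distribution and the link -/

variable (X) in
/-- The total mass of the speed measure. -/
def speedMass : ℝ := ∫ y in (0 : ℝ)..1, X.m y

lemma ReflectingOrEntrance.speedMass_pos (hX : X.ReflectingOrEntrance) : 0 < X.speedMass :=
  intervalIntegral.intervalIntegral_pos_of_pos_on hX.intervalIntegrable_m
    (fun _ hx => X.m_pos hx) zero_lt_one

lemma statDensity_eq (x : ℝ) : X.statDensity x = X.m x / X.speedMass := rfl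

lemma ReflectingOrEntrance.statDensity_pos (hX : X.ReflectingOrEntrance) {x : ℝ}
    (hx : x ∈ Ioo (0 : ℝ) 1) : 0 < X.statDensity x :=
  div_pos (X.m_pos hx) hX.speedMass_pos

lemma continuousOn_statDensity : ContinuousOn X.statDensity (Ioo 0 1) :=
  X.continuousOn_m.div_const _

lemma ReflectingOrEntrance.intervalIntegrable_statDensity (hX : X.ReflectingOrEntrance) {x y : ℝ}
    (hx : x ∈ Icc (0 : ℝ) 1) (hy : y ∈ Icc (0 : ℝ) 1) :
    IntervalIntegrable X.statDensity volume x y := by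
  refine (hX.intervalIntegrable_m.mono_set ?_).div_const _
  rw [uIcc_of_le zero_le_one]
  exact ordConnected_Icc.uIcc_subset hx hy

lemma ReflectingOrEntrance.statCDF_pos (hX : X.ReflectingOrEntrance) {x : ℝ}
    (hx : x ∈ Ioc (0 : ℝ) 1) : 0 < X.statCDF x :=
  intervalIntegral.intervalIntegral_pos_of_pos_on
    (hX.intervalIntegrable_statDensity (left_mem_Icc.2 zero_le_one) (Ioc_subset_Icc_self hx))
    (fun _ hy => hX.statDensity_pos ⟨hy.1, hy.2.trans_le hx.2⟩) hx.1

lemma ReflectingOrEntrance.statCDF_one (hX : X.ReflectingOrEntrance) : X.statCDF 1 = 1 := by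
  have : X.statCDF 1 = X.speedMass / X.speedMass := intervalIntegral.integral_div _ _
  rw [this, div_self hX.speedMass_pos.ne']

lemma ReflectingOrEntrance.hasDerivAt_statCDF (hX : X.ReflectingOrEntrance) {x : ℝ}
    (hx : x ∈ Ioo (0 : ℝ) 1) : HasDerivAt X.statCDF (X.statDensity x) x :=
  hasDerivAt_integral_of_continuousOn continuousOn_statDensity
    (hX.intervalIntegrable_statDensity (left_mem_Icc.2 zero_le_one) (Ioo_subset_Icc_self hx)) hx

lemma ReflectingOrEntrance.continuousOn_statCDF (hX : X.ReflectingOrEntrance) :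
    ContinuousOn X.statCDF (Icc 0 1) := by
  have := intervalIntegral.continuousOn_primitive_interval' (hX.intervalIntegrable_statDensity
    (left_mem_Icc.2 zero_le_one) (right_mem_Icc.2 zero_le_one)) left_mem_uIcc
  rwa [uIcc_of_le zero_le_one] at this

lemma statCDF_zero : X.statCDF 0 = 0 := intervalIntegral.integral_same

lemma ReflectingOrEntrance.strictMonoOn_statCDF (hX : X.ReflectingOrEntrance) :
    StrictMonoOn X.statCDF (Icc 0 1) := by
  refine strictMonoOn_of_deriv_pos (convex_Icc 0 1) hX.continuousOn_statCDF fun x hx => ?_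
  rw [interior_Icc] at hx
  rw [(hX.hasDerivAt_statCDF hx).deriv]
  exact hX.statDensity_pos hx

lemma ReflectingOrEntrance.intervalIntegrable_statDensity_mul (hX : X.ReflectingOrEntrance)
    (f : C(I, ℝ)) {x y : ℝ} (hx : x ∈ Icc (0 : ℝ) 1) (hy : y ∈ Icc (0 : ℝ) 1) :
    IntervalIntegrable (fun y => X.statDensity y * realExt f y) volume x y :=
  (hX.intervalIntegrable_statDensity hx hy).mul_continuousOn (continuous_realExt f).continuousOn

lemma statDensity_mul_integral (g : C(I, ℝ)) (x : ℝ) :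
    ∫ y in (0 : ℝ)..x, X.statDensity y * realExt g y
      = (∫ y in (0 : ℝ)..x, X.m y * realExt g y) / X.speedMass := by
  rw [← intervalIntegral.integral_div]
  congr 1
  ext y
  rw [statDensity_eq]
  ring

lemma link_zero (f : I → ℝ) : X.link f 0 = f 0 := by simp [link]

lemma link_eq_div (f : I → ℝ) {x : I} (hx : (x : ℝ) ∈ Ioc (0 : ℝ) 1) :
    X.link f x = (∫ y in (0 : ℝ)..x, X.statDensity y * realExt f y) / X.statCDF x := by
  have hne : x ≠ 0 := fun h => by simp [h] at hx
  rw [link, if_neg hne, ← intervalIntegral.integral_div]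
  congr 1
  ext y
  ring

lemma ReflectingOrEntrance.statCDF_mul_of_eq_link (hX : X.ReflectingOrEntrance) {f F : C(I, ℝ)}
    (h : ⇑F = X.link f) {x : ℝ} (hx : x ∈ Ioc (0 : ℝ) 1) :
    X.statCDF x * realExt F x = ∫ y in (0 : ℝ)..x, X.statDensity y * realExt f y := by
  rw [realExt_of_mem _ (Ioc_subset_Icc_self hx), h, link_eq_div _ hx,
    mul_div_cancel₀ _ (hX.statCDF_pos hx).ne']

variable (X) in
/-- The logarithmic derivative `π / Π` of the stationary distribution function. -/
def rate (x : ℝ) : ℝ := X.statDensity x / X.statCDF x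

lemma ReflectingOrEntrance.rate_pos (hX : X.ReflectingOrEntrance) {x : ℝ}
    (hx : x ∈ Ioo (0 : ℝ) 1) : 0 < X.rate x :=
  div_pos (hX.statDensity_pos hx) (hX.statCDF_pos (Ioo_subset_Ioc_self hx))

/-- `(Λ f)' = (π / Π) (f - Λ f)`. -/
lemma ReflectingOrEntrance.hasDerivAt_of_eq_link (hX : X.ReflectingOrEntrance) {f F : C(I, ℝ)}
    (h : ⇑F = X.link f) {x : ℝ} (hx : x ∈ Ioo (0 : ℝ) 1) :
    HasDerivAt (realExt F) (X.rate x * (realExt f x - realExt F x)) x := by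
  have h1 : HasDerivAt (fun x => ∫ y in (0 : ℝ)..x, X.statDensity y * realExt f y)
      (X.statDensity x * realExt f x) x :=
    hasDerivAt_integral_of_continuousOn
      (continuousOn_statDensity.mul (continuous_realExt f).continuousOn)
      (hX.intervalIntegrable_statDensity_mul f (left_mem_Icc.2 zero_le_one)
        (Ioo_subset_Icc_self hx)) hx
  have hP := (hX.statCDF_pos (Ioo_subset_Ioc_self hx)).ne'
  have h2 := h1.fun_div (hX.hasDerivAt_statCDF hx) hP
  have e : realExt F =ᶠ[𝓝 x]
      fun x => (∫ y in (0 : ℝ)..x, X.statDensity y * realExt f y) / X.statCDF x := by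
    filter_upwards [isOpen_Ioo.mem_nhds hx] with y hy
    rw [← hX.statCDF_mul_of_eq_link h (Ioo_subset_Ioc_self hy),
      mul_div_cancel_left₀ _ (hX.statCDF_pos (Ioo_subset_Ioc_self hy)).ne']
  refine (h2.congr_of_eventuallyEq e).congr_deriv ?_
  rw [← hX.statCDF_mul_of_eq_link h (Ioo_subset_Ioc_self hx), rate]
  field_simp

/-- The converse of `hasDerivAt_of_eq_link`: the differential equation characterizes `Λ f` among
the continuous functions with the value `f(0)` at `0`. -/
lemma ReflectingOrEntrance.eq_link_of_hasDerivAt (hX : X.ReflectingOrEntrance) {f F : C(I, ℝ)}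
    (h0 : F 0 = f 0) (hd : ∀ x ∈ Ioo (0 : ℝ) 1,
      HasDerivAt (realExt F) (X.rate x * (realExt f x - realExt F x)) x) : ⇑F = X.link f := by
  ext x
  rcases eq_or_ne x 0 with rfl | hx0
  · rw [link_zero, h0]
  · have hx : (x : ℝ) ∈ Ioc (0 : ℝ) 1 := ⟨unitInterval.pos_iff_ne_zero.2 hx0, x.2.2⟩
    rw [link_eq_div _ hx, eq_div_iff (hX.statCDF_pos hx).ne']
    have hI : Icc (0 : ℝ) x ⊆ Icc 0 1 := Icc_subset_Icc_right hx.2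
    have h1 := intervalIntegral.integral_eq_sub_of_hasDerivAt_of_le (a := 0) (b := x)
      (f := fun y => realExt F y * X.statCDF y) (f' := fun y => X.statDensity y * realExt f y)
      hx.1.le (((continuous_realExt F).continuousOn).mul (hX.continuousOn_statCDF.mono hI))
      (fun y hy => ?_) (hX.intervalIntegrable_statDensity_mul f (left_mem_Icc.2 zero_le_one) x.2)
    · rw [h1, statCDF_zero, mul_zero, sub_zero, realExt_coe]
    · have hy' : y ∈ Ioo (0 : ℝ) 1 := ⟨hy.1, hy.2.trans_le hx.2⟩
      refine ((hd y hy').mul (hX.hasDerivAt_statCDF hy')).congr_deriv ?_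
      have hP := (hX.statCDF_pos (Ioo_subset_Ioc_self hy')).ne'
      rw [rate]
      field_simp
      ring

/-- `Λ A f = (df/dS) / (2 Π ∫ dM)`. -/
lemma ReflectingOrEntrance.link_gen_eq (hX : X.ReflectingOrEntrance) {f g G : C(I, ℝ)}
    (h : X.HasGen f g) (hG : ⇑G = X.link g) {x : ℝ} (hx : x ∈ Ioo (0 : ℝ) 1) :
    realExt G x = X.flux f x / (2 * X.speedMass * X.statCDF x) := by
  have h1 := hX.statCDF_mul_of_eq_link hG (Ioo_subset_Ioc_self hx)
  have hP := (hX.statCDF_pos (Ioo_subset_Ioc_self hx)).ne'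
  have hZ := hX.speedMass_pos.ne'
  rw [statDensity_mul_integral, eq_div_iff hZ] at h1
  rw [hX.flux_eq h hx, ← h1]
  field_simp

lemma ReflectingOrEntrance.link_gen_one_eq_zero (hX : X.ReflectingOrEntrance) {f g G : C(I, ℝ)}
    (h : X.HasGen f g) (hG : ⇑G = X.link g) : G 1 = 0 := by
  rw [hG, link_eq_div _ (by simp), statDensity_mul_integral]
  have := hX.integral_m_mul_eq_zero h
  simp [this]

/-- The weighted average `(Λ f)(x)` is less than an upper bound `c` of `f` on `(0, x]` that `f` does
not attain everywhere. -/
lemma ReflectingOrEntrance.realExt_lt_of_eq_link (hX : X.ReflectingOrEntrance) {f F : C(I, ℝ)}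
    (h : ⇑F = X.link f) {x c : ℝ} (hx : x ∈ Ioc (0 : ℝ) 1)
    (hle : ∀ y ∈ Ioc 0 x, realExt f y ≤ c) (hlt : ∃ y ∈ Ioo 0 x, realExt f y < c) :
    realExt F x < c := by
  have hP := hX.statCDF_pos hx
  have h1 := hX.statCDF_mul_of_eq_link h hx
  have hI : Ioo 0 x ⊆ Ioo 0 1 := Ioo_subset_Ioo_right hx.2
  have h2 : ∫ y in (0 : ℝ)..x, X.statDensity y * realExt f y
      < ∫ y in (0 : ℝ)..x, X.statDensity y * c := by
    refine intervalIntegral.integral_lt_integral_of_ae_le_of_measure_setOfPred_lt_ne_zero hx.1.le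
      (hX.intervalIntegrable_statDensity_mul f (left_mem_Icc.2 zero_le_one)
        (Ioc_subset_Icc_self hx))
      ((hX.intervalIntegrable_statDensity (left_mem_Icc.2 zero_le_one)
        (Ioc_subset_Icc_self hx)).mul_const c) ?_ ?_
    · rw [← restrict_Ioo_eq_restrict_Ioc]
      filter_upwards [ae_restrict_mem measurableSet_Ioo] with y hy
      exact mul_le_mul_of_nonneg_left (hle y (Ioo_subset_Ioc_self hy))
        (hX.statDensity_pos (hI hy)).le
    · have ho : IsOpen (Ioo 0 x ∩ {y | realExt f y < c}) :=
        isOpen_Ioo.inter (isOpen_lt (continuous_realExt f) continuous_const)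
      obtain ⟨y₀, hy₀, hy₀'⟩ := hlt
      have hpos := ho.measure_pos volume ⟨y₀, hy₀, hy₀'⟩
      rw [← Measure.restrict_apply_self] at hpos
      refine ne_of_gt (hpos.trans_le ?_)
      refine (Measure.restrict_mono (inter_subset_left.trans Ioo_subset_Ioc_self) le_rfl _).trans
        (measure_mono ?_)
      rintro y ⟨hy, hy'⟩
      exact mul_lt_mul_of_pos_left hy' (hX.statDensity_pos (hI hy))
  rw [intervalIntegral.integral_mul_const, ← h1] at h2
  exact lt_of_mul_lt_mul_left h2 hP.le

/-! ### The coefficients of the dual -/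

/-- Compactly supported `C²` functions on the open interval belong to the domain. -/
lemma ReflectingOrEntrance.exists_hasGen_of_tsupport_subset (hX : X.ReflectingOrEntrance)
    {ψ : ℝ → ℝ} (hψ : ContDiff ℝ 2 ψ) (hs : tsupport ψ ⊆ Ioo 0 1) :
    ∃ f g : C(I, ℝ), X.HasGen f g ∧ ∀ x ∈ Ioo (0 : ℝ) 1, realExt f x = ψ x := by
  have hs1 : tsupport (deriv ψ) ⊆ tsupport ψ :=
    closure_minimal (support_deriv_subset) (isClosed_tsupport _)
  have hs2 : tsupport (deriv (deriv ψ)) ⊆ tsupport (deriv ψ) :=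
    closure_minimal (support_deriv_subset) (isClosed_tsupport _)
  have hc1 : Continuous (deriv ψ) := hψ.continuous_deriv (by norm_num)
  have hc2 : Continuous (deriv (deriv ψ)) :=
    (ContDiff.deriv' (n := 1) hψ).continuous_deriv le_rfl
  have key : ∀ {c η : ℝ → ℝ}, ContinuousOn c (Ioo 0 1) → Continuous η → tsupport η ⊆ Ioo 0 1 →
      Continuous fun x => c x * η x := by
    intro c η hc hη hsub
    exact ContinuousOn.continuous_of_tsupport_subset (hc.mul hη.continuousOn) isOpen_Ioo
      ((tsupport_mul_subset_right).trans hsub)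
  have hgc : Continuous fun x => 1 / 2 * (X.b x * deriv (deriv ψ) x) + X.a x * deriv ψ x :=
    (continuous_const.mul (key X.b_cont hc2 ((hs2.trans hs1).trans hs))).add
      (key X.a_cont hc1 (hs1.trans hs))
  set f : C(I, ℝ) := ⟨fun x => ψ x, hψ.continuous.comp continuous_subtype_val⟩ with hf
  set g : C(I, ℝ) := ⟨_, hgc.comp continuous_subtype_val⟩ with hg
  have hfψ : ∀ x ∈ Ioo (0 : ℝ) 1, realExt f x = ψ x := fun x hx => by
    rw [realExt_of_mem _ (Ioo_subset_Icc_self hx)]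
    rfl
  have hd : ∀ x ∈ Ioo (0 : ℝ) 1, deriv (realExt f) x = deriv ψ x := fun x hx =>
    EventuallyEq.deriv_eq (Filter.eventually_of_mem (isOpen_Ioo.mem_nhds hx) hfψ)
  have hd2 : ∀ x ∈ Ioo (0 : ℝ) 1, deriv (deriv (realExt f)) x = deriv (deriv ψ) x := fun x hx =>
    EventuallyEq.deriv_eq (Filter.eventually_of_mem (isOpen_Ioo.mem_nhds hx) hd)
  have hi : X.InteriorGen f g := by
    refine ⟨hψ.contDiffOn.congr hfψ, fun x hx => ?_⟩
    rw [hd x hx, hd2 x hx, realExt_of_mem _ (Ioo_subset_Icc_self hx)]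
    simp only [hg, ContinuousMap.coe_mk, Function.comp]
    ring
  have hfl : ∀ (l : Filter ℝ) (e : ℝ), Ioo (0 : ℝ) 1 ∈ l → l ≤ 𝓝 e → e ∉ Ioo (0 : ℝ) 1 →
      Tendsto (X.flux f) l (𝓝 0) := by
    intro l e hl hle he
    refine tendsto_const_nhds.congr' ?_
    have hn : (tsupport ψ)ᶜ ∈ l :=
      hle ((isClosed_tsupport ψ).isOpen_compl.mem_nhds fun h => he (hs h))
    filter_upwards [hl, hn] with x hx hx'
    rw [flux, hd x hx, image_eq_zero_of_notMem_tsupport fun h => hx' (hs1 h), zero_div]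
  exact ⟨f, g, hX.hasGen_of_interiorGen hi
    (hfl _ 0 (Ioo_mem_nhdsGT zero_lt_one) nhdsWithin_le_nhds (by simp))
    (hfl _ 1 (Ioo_mem_nhdsLT zero_lt_one) nhdsWithin_le_nhds (by simp)), hfψ⟩

lemma hasDerivAt_b (hb : ContDiffOn ℝ 1 X.b (Ioo 0 1)) {x : ℝ} (hx : x ∈ Ioo (0 : ℝ) 1) :
    HasDerivAt X.b (deriv X.b x) x :=
  ((hb.differentiableOn (by norm_num)).differentiableAt (isOpen_Ioo.mem_nhds hx)).hasDerivAt

lemma hasDerivAt_m (hb : ContDiffOn ℝ 1 X.b (Ioo 0 1)) {x : ℝ} (hx : x ∈ Ioo (0 : ℝ) 1) :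
    HasDerivAt X.m (X.m x * ((2 * X.a x - deriv X.b x) / X.b x)) x := by
  have hb0 := (X.b_pos x hx).ne'
  have hs0 := (X.s_pos x).ne'
  refine (((X.hasDerivAt_s hx).mul (hasDerivAt_b hb hx)).fun_inv
    (mul_ne_zero hs0 hb0)).congr_deriv ?_
  simp only [m, Pi.mul_apply]
  field_simp
  ring

lemma ReflectingOrEntrance.hasDerivAt_rate (hX : X.ReflectingOrEntrance)
    (hb : ContDiffOn ℝ 1 X.b (Ioo 0 1)) {x : ℝ} (hx : x ∈ Ioo (0 : ℝ) 1) :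
    HasDerivAt X.rate (X.rate x * ((2 * X.a x - deriv X.b x) / X.b x - X.rate x)) x := by
  have hP := (hX.statCDF_pos (Ioo_subset_Ioc_self hx)).ne'
  refine (((hasDerivAt_m hb hx).div_const X.speedMass).fun_div
    (hX.hasDerivAt_statCDF hx) hP).congr_deriv ?_
  have hZ := hX.speedMass_pos.ne'
  simp only [rate, statDensity_eq]
  field_simp

variable (X) in
/-- The drift coefficient of the strong stationary dual. -/
def dualDrift (x : ℝ) : ℝ := 1 / 2 * deriv X.b x - X.a x + X.b x * X.rate x

variable {Xs : FellerDiffusion}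

/-- Intertwining along a function of the domain: a first-order relation at every interior point,
linear in `f - Λ f` and `f'`. -/
lemma ReflectingOrEntrance.intertwining_relation (hX : X.ReflectingOrEntrance)
    (hb : ContDiffOn ℝ 1 X.b (Ioo 0 1)) (hdual : IsStrongStationaryDual X Xs) {f g F : C(I, ℝ)}
    (h : X.HasGen f g) (hF : ⇑F = X.link f) {x : ℝ} (hx : x ∈ Ioo (0 : ℝ) 1) :
    1 / 2 * X.b x * deriv (realExt f) x
      = (1 / 2 * Xs.b x * ((2 * X.a x - deriv X.b x) / X.b x - 2 * X.rate x) + Xs.a x)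
          * (realExt f x - realExt F x) + 1 / 2 * Xs.b x * deriv (realExt f) x := by
  obtain ⟨F', ⟨G, hG⟩, hF'⟩ := hdual.maps_domain f ⟨g, h⟩
  obtain rfl : F' = F := DFunLike.coe_injective (hF'.trans hF.symm)
  have hGl := hdual.intertwine f g F' G h hG hF
  have hd : deriv (realExt F') =ᶠ[𝓝 x] fun y => X.rate y * (realExt f y - realExt F' y) := by
    filter_upwards [isOpen_Ioo.mem_nhds hx] with y hy using (hX.hasDerivAt_of_eq_link hF hy).deriv
  have hd2 := ((hX.hasDerivAt_rate hb hx).fun_mul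
    ((hasDerivAt_of_contDiffOn (X.dom_C2 f g h) hx).fun_sub (hX.hasDerivAt_of_eq_link hF hx))).deriv
  have e1 := (interiorGen_of_hasGen hG).2 x hx
  rw [hX.link_gen_eq h hGl hx, hd.deriv_eq, hd.eq_of_nhds, hd2] at e1
  have hb0 := (X.b_pos x hx).ne'
  have hs0 := (X.s_pos x).ne'
  have hP := (hX.statCDF_pos (Ioo_subset_Ioc_self hx)).ne'
  have hZ := hX.speedMass_pos.ne'
  have e2 : X.flux f x / (2 * X.speedMass * X.statCDF x)
      = X.rate x * (1 / 2 * X.b x * deriv (realExt f) x) := by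
    rw [flux, rate, statDensity_eq, m]
    field_simp
  rw [e2] at e1
  apply mul_left_cancel₀ (hX.rate_pos hx).ne'
  rw [e1]
  ring

/-- The coefficients are read off at `x` from a bump function `φ` with `φ(x) = 1` and from
`y ↦ (y - x) φ(y)`. -/
theorem ReflectingOrEntrance.dual_coefficients (hX : X.ReflectingOrEntrance)
    (hb : ContDiffOn ℝ 1 X.b (Ioo 0 1)) (hdual : IsStrongStationaryDual X Xs) {x : ℝ}
    (hx : x ∈ Ioo (0 : ℝ) 1) : Xs.b x = X.b x ∧ Xs.a x = X.dualDrift x := by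
  obtain ⟨r, hr0, hr⟩ := Metric.nhds_basis_closedBall.mem_iff.1 (isOpen_Ioo.mem_nhds hx)
  let φ : ContDiffBump x := ⟨r / 2, r, by positivity, by linarith⟩
  have hφs : tsupport φ ⊆ Ioo 0 1 := φ.tsupport_eq.trans_subset hr
  have hφ1 : (φ : ℝ → ℝ) =ᶠ[𝓝 x] fun _ => 1 := φ.eventuallyEq_one
  obtain ⟨f₁, g₁, h₁, e₁⟩ := hX.exists_hasGen_of_tsupport_subset (φ.contDiff (n := 2)) hφs
  have hψ : ContDiff ℝ 2 fun y => (y - x) * φ y := by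
    exact (contDiff_id.sub contDiff_const).mul φ.contDiff
  obtain ⟨f₂, g₂, h₂, e₂⟩ := hX.exists_hasGen_of_tsupport_subset hψ
    ((tsupport_mul_subset_right).trans hφs)
  obtain ⟨F₁, -, hF₁⟩ := hdual.maps_domain f₁ ⟨g₁, h₁⟩
  obtain ⟨F₂, -, hF₂⟩ := hdual.maps_domain f₂ ⟨g₂, h₂⟩
  have E₁ : realExt f₁ =ᶠ[𝓝 x] fun _ => 1 := by
    filter_upwards [isOpen_Ioo.mem_nhds hx, hφ1] with y hy hy' using (e₁ y hy).trans hy'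
  have E₂ : realExt f₂ =ᶠ[𝓝 x] fun y => y - x := by
    filter_upwards [isOpen_Ioo.mem_nhds hx, hφ1] with y hy hy'
    rw [e₂ y hy, hy', mul_one]
  have d₁ : deriv (realExt f₁) x = 0 := by rw [E₁.deriv_eq, deriv_const]
  have d₂ : deriv (realExt f₂) x = 1 := by
    rw [E₂.deriv_eq]
    exact ((hasDerivAt_id x).sub_const x).deriv
  have hlt : realExt F₁ x < 1 := by
    have hx0 : 0 < x - r := by
      have : x - r ∈ Metric.closedBall x r := by simp [abs_of_pos hr0]
      exact (hr this).1
    refine hX.realExt_lt_of_eq_link hF₁ (Ioo_subset_Ioc_self hx) (fun y hy => ?_)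
      ⟨x - r, ⟨hx0, by linarith⟩, ?_⟩
    · rw [e₁ y ⟨hy.1, hy.2.trans_lt hx.2⟩]
      exact φ.le_one
    · rw [e₁ _ ⟨hx0, by linarith [hx.2]⟩, φ.zero_of_le_dist]
      · exact zero_lt_one
      · simp [φ, abs_of_pos hr0]
  have R₁ := hX.intertwining_relation hb hdual h₁ hF₁ hx
  have R₂ := hX.intertwining_relation hb hdual h₂ hF₂ hx
  rw [d₁, mul_zero, mul_zero, add_zero, E₁.eq_of_nhds] at R₁
  have hK := (mul_eq_zero.1 R₁.symm).resolve_right (sub_ne_zero.2 hlt.ne')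
  rw [d₂, hK, zero_mul, zero_add, mul_one, mul_one] at R₂
  have hbb : Xs.b x = X.b x := by linarith
  refine ⟨hbb, ?_⟩
  rw [hbb] at hK
  have hb0 := (X.b_pos x hx).ne'
  have : 1 / 2 * X.b x * ((2 * X.a x - deriv X.b x) / X.b x - 2 * X.rate x)
      = 1 / 2 * (2 * X.a x - deriv X.b x) - X.b x * X.rate x := by
    field_simp
  rw [this] at hK
  rw [dualDrift]
  linarith

/-! ### Boundary classification of the dual -/

variable (X) in
/-- The normalizing factor in the scale density of the dual; it comes from the base point `1/2`. -/
def scaleConst : ℝ := X.statCDF (1 / 2) ^ 2 / X.m (1 / 2)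

lemma ReflectingOrEntrance.scaleConst_pos (hX : X.ReflectingOrEntrance) : 0 < X.scaleConst :=
  div_pos (pow_pos (hX.statCDF_pos (Ioo_subset_Ioc_self half_mem)) 2) (X.m_pos half_mem)

/-- The scale density of the dual is a multiple of `m / Π²`. -/
lemma ReflectingOrEntrance.dual_s_eq (hX : X.ReflectingOrEntrance)
    (hb : ContDiffOn ℝ 1 X.b (Ioo 0 1)) (hdual : IsStrongStationaryDual X Xs) {x : ℝ}
    (hx : x ∈ Ioo (0 : ℝ) 1) : Xs.s x = X.scaleConst * (X.m x / X.statCDF x ^ 2) := by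
  have hd : ∀ y ∈ Ioo (0 : ℝ) 1,
      HasDerivAt (fun y => Xs.s y * (X.statCDF y ^ 2 / X.m y)) 0 y := by
    intro y hy
    have hm := (X.m_pos hy).ne'
    have hP := (hX.statCDF_pos (Ioo_subset_Ioc_self hy)).ne'
    have hb0 := (X.b_pos y hy).ne'
    obtain ⟨eb, ea⟩ := hX.dual_coefficients hb hdual hy
    refine ((Xs.hasDerivAt_s hy).fun_mul (((hX.hasDerivAt_statCDF hy).fun_pow 2).fun_div
      (hasDerivAt_m hb hy) hm)).congr_deriv ?_
    rw [ea, eb, dualDrift, rate]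
    field_simp
    ring
  have hc := isOpen_Ioo.is_const_of_deriv_eq_zero isPreconnected_Ioo
    (fun y hy => (hd y hy).differentiableAt.differentiableWithinAt) (fun y hy => (hd y hy).deriv)
    hx half_mem
  have hm := (X.m_pos hx).ne'
  have hP := (hX.statCDF_pos (Ioo_subset_Ioc_self hx)).ne'
  rw [s_half, one_mul] at hc
  rw [scaleConst, ← hc]
  field_simp

/-- The speed density of the dual is a multiple of `s Π²`. -/
lemma ReflectingOrEntrance.dual_m_eq (hX : X.ReflectingOrEntrance)
    (hb : ContDiffOn ℝ 1 X.b (Ioo 0 1)) (hdual : IsStrongStationaryDual X Xs) {x : ℝ}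
    (hx : x ∈ Ioo (0 : ℝ) 1) : Xs.m x = X.s x * X.statCDF x ^ 2 / X.scaleConst := by
  have hP := (hX.statCDF_pos (Ioo_subset_Ioc_self hx)).ne'
  have hb0 := (X.b_pos x hx).ne'
  have hs0 := (X.s_pos x).ne'
  have hC := hX.scaleConst_pos.ne'
  rw [m, hX.dual_s_eq hb hdual hx, (hX.dual_coefficients hb hdual hx).1, m]
  field_simp

lemma ReflectingOrEntrance.dual_scale_diff (hX : X.ReflectingOrEntrance)
    (hb : ContDiffOn ℝ 1 X.b (Ioo 0 1)) (hdual : IsStrongStationaryDual X Xs) {x y : ℝ}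
    (hx : x ∈ Ioo (0 : ℝ) 1) (hy : y ∈ Ioo (0 : ℝ) 1) : ∫ t in x..y, Xs.s t
      = X.scaleConst * X.speedMass * ((X.statCDF x)⁻¹ - (X.statCDF y)⁻¹) := by
  have hd : ∀ t ∈ uIcc x y, HasDerivAt
      (fun t => -(X.scaleConst * X.speedMass) * (X.statCDF t)⁻¹) (Xs.s t) t := by
    intro t ht
    have ht' := uIcc_subset_unit hx hy ht
    have hP := (hX.statCDF_pos (Ioo_subset_Ioc_self ht')).ne'
    have hZ := hX.speedMass_pos.ne'
    refine (((hX.hasDerivAt_statCDF ht').fun_inv hP).const_mul _).congr_deriv ?_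
    rw [hX.dual_s_eq hb hdual ht', statDensity_eq]
    field_simp
  rw [intervalIntegral.integral_eq_sub_of_hasDerivAt hd
    (intervalIntegrable_of_continuousOn_unit Xs.continuousOn_s hx hy)]
  ring

/-- Integration by parts turns `N(0) < ∞` into integrability of `s(y) ∫_0^y dM` at `0`. -/
lemma ReflectingOrEntrance.integrableOn_s_mul_speed (hX : X.ReflectingOrEntrance) :
    IntegrableOn (fun y => X.s y * ∫ t in (0 : ℝ)..y, X.m t) (Ioc 0 (1 / 2)) := by
  have hsub : Ioc (0 : ℝ) (1 / 2) ⊆ Ioo 0 1 := Ioc_subset_Ioo_right half_mem.2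
  have hD : ∀ {y}, y ∈ Ioo (0 : ℝ) 1 → HasDerivAt X.S (X.s y) y := fun hy =>
    hasDerivAt_integral_of_continuousOn X.continuousOn_s
      (intervalIntegrable_of_continuousOn_unit X.continuousOn_s half_mem hy) hy
  set k : ℝ → ℝ := fun y => (X.S (1 / 2) - X.S y) * X.m y with hk
  set μ : ℝ → ℝ := fun y => ∫ t in (0 : ℝ)..y, X.m t with hμ
  have hkc : ContinuousOn k (Ioo 0 1) := (continuousOn_const.sub
    fun y hy => (hD hy).continuousAt.continuousWithinAt).mul X.continuousOn_m
  have hS : ∀ {x y : ℝ}, x ∈ Ioo (0 : ℝ) 1 → y ∈ Ioo (0 : ℝ) 1 → x ≤ y → X.S x ≤ X.S y := by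
    intro x y hx hy hxy
    have h1 := intervalIntegral.integral_add_adjacent_intervals
      (intervalIntegrable_of_continuousOn_unit X.continuousOn_s half_mem hx)
      (intervalIntegrable_of_continuousOn_unit X.continuousOn_s hx hy)
    have h2 : 0 ≤ ∫ t in x..y, X.s t :=
      intervalIntegral.integral_nonneg hxy fun t _ => (X.s_pos t).le
    simp only [S]
    linarith
  have hki : IntegrableOn k (Ioc 0 (1 / 2)) :=
    integrableOn_of_lintegral_ofReal (c := 1) measurableSet_Ioc one_pos (hkc.mono hsub)
      (fun y hy => mul_nonneg (sub_nonneg.2 (hS (hsub hy) half_mem hy.2)) (X.m_pos (hsub hy)).le)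
      (fun y _ => (one_mul _).le) hX.N0_lt_top
  have hkI : ∀ {y}, y ∈ Icc (0 : ℝ) (1 / 2) → IntervalIntegrable k volume 0 y := fun {y} hy =>
    (intervalIntegrable_iff_integrableOn_Ioc_of_le hy.1).2
      (hki.mono_set (Ioc_subset_Ioc_right hy.2))
  have hmI : ∀ {y}, y ∈ Icc (0 : ℝ) (1 / 2) → IntervalIntegrable X.m volume 0 y := fun {y} hy =>
    hX.intervalIntegrable_m.mono_set (by
      rw [uIcc_of_le hy.1, uIcc_of_le zero_le_one]
      exact Icc_subset_Icc_right (by linarith [hy.2]))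
  have hμ0 : ∀ y ∈ Ioc (0 : ℝ) (1 / 2), 0 ≤ μ y := fun y hy => by
    refine intervalIntegral.intervalIntegral_pos_of_pos_on (hmI (Ioc_subset_Icc_self hy))
      (fun t ht => X.m_pos ⟨ht.1, ?_⟩) hy.1 |>.le
    linarith [ht.2, hy.2]
  set K : ℝ → ℝ := fun y => ∫ t in (0 : ℝ)..y, k t with hK
  have hKc : ContinuousOn K (Icc 0 (1 / 2)) := by
    have := intervalIntegral.continuousOn_primitive_interval'
      (hkI (right_mem_Icc.2 (by norm_num : (0 : ℝ) ≤ 1 / 2))) left_mem_uIcc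
    rwa [uIcc_of_le (by norm_num)] at this
  have hμc : ContinuousOn μ (Icc 0 (1 / 2)) := by
    have := intervalIntegral.continuousOn_primitive_interval'
      (hmI (right_mem_Icc.2 (by norm_num : (0 : ℝ) ≤ 1 / 2))) left_mem_uIcc
    rwa [uIcc_of_le (by norm_num)] at this
  have hμK : ∀ y ∈ Ioc (0 : ℝ) (1 / 2), (X.S (1 / 2) - X.S y) * μ y ≤ K y := by
    intro y hy
    rw [hμ, ← intervalIntegral.integral_const_mul]
    refine intervalIntegral.integral_mono_on_of_le_Ioo hy.1.le
      ((hmI (Ioc_subset_Icc_self hy)).const_mul _) (hkI (Ioc_subset_Icc_self hy)) fun t ht => ?_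
    have ht' : t ∈ Ioc (0 : ℝ) (1 / 2) := ⟨ht.1, ht.2.le.trans hy.2⟩
    refine mul_le_mul_of_nonneg_right ?_ (X.m_pos (hsub ht')).le
    linarith [hS (hsub ht') (hsub hy) ht.2.le]
  -- `Ψ` vanishes at `0`, is continuous there by `hμK`, and has the derivative `s μ`.
  set Ψ : ℝ → ℝ := fun y => K y - (X.S (1 / 2) - X.S y) * μ y with hΨ
  have hμz : μ 0 = 0 := intervalIntegral.integral_same
  have hKz : K 0 = 0 := intervalIntegral.integral_same
  refine intervalIntegral.integrableOn_deriv_of_nonneg (g := Ψ) ?_ ?_ ?_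
  · intro y hy
    rcases hy.1.eq_or_lt with rfl | h0
    · have hK0 : Tendsto K (𝓝[Icc 0 (1 / 2)] 0) (𝓝 0) := by
        have := hKc 0 hy
        rwa [ContinuousWithinAt, hKz] at this
      have hΨz : Ψ 0 = 0 := by simp only [hΨ, hμz, hKz]; ring
      rw [ContinuousWithinAt, hΨz]
      refine squeeze_zero' ?_ ?_ hK0
      · filter_upwards [self_mem_nhdsWithin] with t ht
        rcases ht.1.eq_or_lt with rfl | h0
        · exact hΨz.ge
        · exact sub_nonneg.2 (hμK t ⟨h0, ht.2⟩)
      · filter_upwards [self_mem_nhdsWithin] with t ht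
        rcases ht.1.eq_or_lt with rfl | h0
        · rw [hΨz, hKz]
        · exact sub_le_self _ (mul_nonneg (sub_nonneg.2
            (hS (hsub ⟨h0, ht.2⟩) half_mem ht.2)) (hμ0 t ⟨h0, ht.2⟩))
    · exact (hKc y hy).sub ((continuousWithinAt_const.sub
        (hD (hsub ⟨h0, hy.2⟩)).continuousAt.continuousWithinAt).mul (hμc y hy))
  · intro y hy
    have hy' := hsub (Ioo_subset_Ioc_self hy)
    have d1 : HasDerivAt K (k y) y :=
      hasDerivAt_integral_of_continuousOn hkc (hkI (Ioo_subset_Icc_self hy)) hy'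
    have d2 : HasDerivAt μ (X.m y) y :=
      hasDerivAt_integral_of_continuousOn X.continuousOn_m (hmI (Ioo_subset_Icc_self hy)) hy'
    refine (d1.sub (((hD hy').const_sub (X.S (1 / 2))).mul d2)).congr_deriv ?_
    simp only [hk]
    ring
  · exact fun y hy => mul_nonneg (X.s_pos y).le (hμ0 y (Ioo_subset_Ioc_self hy))

theorem ReflectingOrEntrance.dual_entrance0 (hX : X.ReflectingOrEntrance)
    (hb : ContDiffOn ℝ 1 X.b (Ioo 0 1)) (hdual : IsStrongStationaryDual X Xs) : Xs.Entrance0 := by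
  have hsub : Ioc (0 : ℝ) (1 / 2) ⊆ Ioo 0 1 := Ioc_subset_Ioo_right half_mem.2
  have hZ := hX.speedMass_pos
  have hC := hX.scaleConst_pos
  constructor
  · refine lintegral_ofReal_lt_top_of_le measurableSet_Ioc hX.integrableOn_s_mul_speed
      fun y hy => ?_
    have hy' := hsub hy
    have hP := hX.statCDF_pos (Ioo_subset_Ioc_self hy')
    have e1 : Xs.S (1 / 2) - Xs.S y
        = X.scaleConst * X.speedMass * ((X.statCDF y)⁻¹ - (X.statCDF (1 / 2))⁻¹) := by
      rw [S, S, intervalIntegral.integral_same, zero_sub, ← intervalIntegral.integral_symm]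
      exact hX.dual_scale_diff hb hdual hy' half_mem
    have e2 : ∫ t in (0 : ℝ)..y, X.m t = X.speedMass * X.statCDF y := by
      have : X.statCDF y = (∫ t in (0 : ℝ)..y, X.m t) / X.speedMass :=
        intervalIntegral.integral_div _ _
      rw [this]
      field_simp
    have h1 : 0 ≤ (X.statCDF (1 / 2))⁻¹ :=
      (inv_pos.2 (hX.statCDF_pos (Ioo_subset_Ioc_self half_mem))).le
    have h2 : Xs.S (1 / 2) - Xs.S y ≤ X.scaleConst * X.speedMass * (X.statCDF y)⁻¹ := by
      rw [e1]
      exact mul_le_mul_of_nonneg_left (by linarith) (by positivity)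
    refine (mul_le_mul_of_nonneg_right h2 (Xs.m_pos hy').le).trans_eq ?_
    rw [hX.dual_m_eq hb hdual hy', e2]
    field_simp
  · by_contra hfin
    have hs : IntegrableOn Xs.s (Ioc 0 (1 / 2)) :=
      integrableOn_left_of_lintegral Xs.continuousOn_m Xs.continuousOn_s
        (fun _ hx => Xs.m_pos hx) (fun x _ => Xs.s_pos x) (lt_top_iff_ne_top.2 hfin)
    -- Integrability of the scale density would bound `1 / Π` near `0`.
    set B := ∫ t in Ioc (0 : ℝ) (1 / 2), Xs.s t with hB
    have hbd : ∀ y ∈ Ioc (0 : ℝ) (1 / 2),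
        1 ≤ (B / (X.scaleConst * X.speedMass) + (X.statCDF (1 / 2))⁻¹) * X.statCDF y := by
      intro y hy
      have hP := hX.statCDF_pos (Ioo_subset_Ioc_self (hsub hy))
      have h1 : ∫ t in y..(1 / 2 : ℝ), Xs.s t ≤ B := by
        rw [intervalIntegral.integral_of_le hy.2]
        exact setIntegral_mono_set hs (Eventually.of_forall fun t => (Xs.s_pos t).le)
          (Ioc_subset_Ioc_left hy.1.le).eventuallyLE
      rw [hX.dual_scale_diff hb hdual (hsub hy) half_mem, ← le_div_iff₀' (by positivity),
        sub_le_iff_le_add] at h1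
      rwa [inv_le_iff_one_le_mul₀ hP] at h1
    have ht : Tendsto X.statCDF (𝓝[>] 0) (𝓝 0) := by
      have h0 := (hX.continuousOn_statCDF 0 (left_mem_Icc.2 zero_le_one)).mono Ioo_subset_Icc_self
      rwa [ContinuousWithinAt, nhdsWithin_Ioo_eq_nhdsGT zero_lt_one, statCDF_zero] at h0
    have h2 := ge_of_tendsto (ht.const_mul (B / (X.scaleConst * X.speedMass)
      + (X.statCDF (1 / 2))⁻¹)) (Filter.eventually_of_mem (Ioc_mem_nhdsGT half_mem.1) hbd)
    rw [mul_zero] at h2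
    exact absurd h2 (by norm_num)

/-- Comparison of the double integrals that classify the boundary point `1`. -/
lemma lintegral_right_lt_top_of_le {p₁ p₂ q₁ q₂ : ℝ → ℝ} {K L : ℝ} (hK : 0 ≤ K) (hL : 0 ≤ L)
    (hp₁ : ContinuousOn p₁ (Ioo 0 1)) (hp₂ : ContinuousOn p₂ (Ioo 0 1))
    (h0 : ∀ y ∈ Ioo (0 : ℝ) 1, 0 < p₁ y ∧ 0 < q₁ y)
    (hp : ∀ y ∈ Ico (1 / 2 : ℝ) 1, p₁ y ≤ K * p₂ y) (hq : ∀ y ∈ Ico (1 / 2 : ℝ) 1, q₁ y ≤ L * q₂ y)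
    (h : ∫⁻ y in Ico (1 / 2 : ℝ) 1, ENNReal.ofReal
      (((∫ t in (1 / 2 : ℝ)..y, p₂ t) - ∫ t in (1 / 2 : ℝ)..(1 / 2), p₂ t) * q₂ y) < ∞) :
    ∫⁻ y in Ico (1 / 2 : ℝ) 1, ENNReal.ofReal
      (((∫ t in (1 / 2 : ℝ)..y, p₁ t) - ∫ t in (1 / 2 : ℝ)..(1 / 2), p₁ t) * q₁ y) < ∞ := by
  have hsub : Ico (1 / 2 : ℝ) 1 ⊆ Ioo 0 1 := Ico_subset_Ioo_left half_mem.1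
  simp only [intervalIntegral.integral_same, sub_zero] at h ⊢
  have h2 := ENNReal.mul_lt_top (ENNReal.ofReal_lt_top (r := K * L)) h
  rw [← lintegral_const_mul' _ _ ENNReal.ofReal_ne_top] at h2
  refine lt_of_le_of_lt (setLIntegral_mono_ae' measurableSet_Ico
    (Eventually.of_forall fun y hy => ?_)) h2
  rw [← ENNReal.ofReal_mul (mul_nonneg hK hL)]
  refine ENNReal.ofReal_le_ofReal ?_
  have hIcc : ∀ t ∈ Icc (1 / 2) y, t ∈ Ico (1 / 2 : ℝ) 1 := fun t ht => ⟨ht.1, ht.2.trans_lt hy.2⟩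
  have hI : ∫ t in (1 / 2 : ℝ)..y, p₁ t ≤ K * ∫ t in (1 / 2 : ℝ)..y, p₂ t := by
    rw [← intervalIntegral.integral_const_mul]
    exact intervalIntegral.integral_mono_on hy.1
      (intervalIntegrable_of_continuousOn_unit hp₁ half_mem (hsub hy))
      ((intervalIntegrable_of_continuousOn_unit hp₂ half_mem (hsub hy)).const_mul K)
      fun t ht => hp t (hIcc t ht)
  have hI0 : 0 ≤ ∫ t in (1 / 2 : ℝ)..y, p₁ t :=
    intervalIntegral.integral_nonneg hy.1 fun t ht => (h0 t (hsub (hIcc t ht))).1.le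
  calc _ ≤ (K * ∫ t in (1 / 2 : ℝ)..y, p₂ t) * (L * q₂ y) :=
        mul_le_mul hI (hq y hy) (h0 y (hsub hy)).2.le (hI0.trans hI)
    _ = _ := by ring

/-- Up to bounded factors, the dual exchanges scale and speed near the boundary point `1`. -/
lemma ReflectingOrEntrance.dual_boundary1 (hX : X.ReflectingOrEntrance)
    (hb : ContDiffOn ℝ 1 X.b (Ioo 0 1)) (hdual : IsStrongStationaryDual X Xs) :
    (X.Sigma1 < ∞ ↔ Xs.N1 < ∞) ∧ (X.N1 < ∞ → Xs.Sigma1 < ∞) := by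
  have hsub : Ico (1 / 2 : ℝ) 1 ⊆ Ioo 0 1 := Ico_subset_Ioo_left half_mem.1
  have hC := hX.scaleConst_pos
  set κ := X.statCDF (1 / 2) with hκ
  have hκ0 : 0 < κ := hX.statCDF_pos (Ioo_subset_Ioc_self half_mem)
  have hlow : ∀ y ∈ Ico (1 / 2 : ℝ) 1, κ ≤ X.statCDF y := fun y hy =>
    hX.strictMonoOn_statCDF.monotoneOn (Ioo_subset_Icc_self half_mem)
      (Ioo_subset_Icc_self (hsub hy)) hy.1
  have hup : ∀ y ∈ Ico (1 / 2 : ℝ) 1, X.statCDF y ≤ 1 := fun y hy => by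
    rw [← hX.statCDF_one]
    exact hX.strictMonoOn_statCDF.monotoneOn (Ioo_subset_Icc_self (hsub hy))
      (right_mem_Icc.2 zero_le_one) hy.2.le
  have hlow2 : ∀ y ∈ Ico (1 / 2 : ℝ) 1, κ ^ 2 ≤ X.statCDF y ^ 2 := fun y hy =>
    pow_le_pow_left₀ hκ0.le (hlow y hy) 2
  have hup2 : ∀ y ∈ Ico (1 / 2 : ℝ) 1, X.statCDF y ^ 2 ≤ 1 := fun y hy =>
    pow_le_one₀ (hκ0.le.trans (hlow y hy)) (hup y hy)
  have hs1 : ∀ y ∈ Ico (1 / 2 : ℝ) 1, Xs.s y ≤ X.scaleConst / κ ^ 2 * X.m y := fun y hy => by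
    have hm := X.m_pos (hsub hy)
    rw [hX.dual_s_eq hb hdual (hsub hy), ← mul_div_assoc, div_mul_eq_mul_div]
    exact div_le_div_of_nonneg_left (by positivity) (by positivity) (hlow2 y hy)
  have hs2 : ∀ y ∈ Ico (1 / 2 : ℝ) 1, X.m y ≤ X.scaleConst⁻¹ * Xs.s y := fun y hy => by
    have hm := X.m_pos (hsub hy)
    have hP := pow_pos (hκ0.trans_le (hlow y hy)) 2
    rw [hX.dual_s_eq hb hdual (hsub hy), inv_mul_cancel_left₀ hC.ne']
    exact le_div_self hm.le hP (hup2 y hy)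
  have hm1 : ∀ y ∈ Ico (1 / 2 : ℝ) 1, Xs.m y ≤ X.scaleConst⁻¹ * X.s y := fun y hy => by
    rw [hX.dual_m_eq hb hdual (hsub hy), div_eq_inv_mul]
    exact mul_le_mul_of_nonneg_left (mul_le_of_le_one_right (X.s_pos y).le (hup2 y hy))
      (inv_pos.2 hC).le
  have hm2 : ∀ y ∈ Ico (1 / 2 : ℝ) 1, X.s y ≤ X.scaleConst / κ ^ 2 * Xs.m y := fun y hy => by
    have e : X.scaleConst / κ ^ 2 * (X.s y * X.statCDF y ^ 2 / X.scaleConst)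
        = X.s y * (X.statCDF y ^ 2 / κ ^ 2) := by
      field_simp
    rw [hX.dual_m_eq hb hdual (hsub hy), e]
    exact le_mul_of_one_le_right (X.s_pos y).le ((one_le_div (by positivity)).2 (hlow2 y hy))
  refine ⟨⟨?_, ?_⟩, ?_⟩
  · exact lintegral_right_lt_top_of_le (by positivity) (by positivity) Xs.continuousOn_s
      X.continuousOn_m (fun y hy => ⟨Xs.s_pos y, Xs.m_pos hy⟩) hs1 hm1
  · exact lintegral_right_lt_top_of_le (by positivity) (by positivity) X.continuousOn_m
      Xs.continuousOn_s (fun y hy => ⟨X.m_pos hy, X.s_pos y⟩) hs2 hm2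
  · exact lintegral_right_lt_top_of_le (by positivity) (by positivity) Xs.continuousOn_m
      X.continuousOn_s (fun y hy => ⟨Xs.m_pos hy, Xs.s_pos y⟩) hm1 hs1

/-! ### Absorption at the right boundary -/

/-- Every `Λ h` with `h` continuous is continuous, since `h = f - A f` for some `f` in the domain
and then `Λ h = Λ f - A* Λ f`. -/
lemma ReflectingOrEntrance.exists_dual_resolvent (hX : X.ReflectingOrEntrance)
    (hdual : IsStrongStationaryDual X Xs) (h : C(I, ℝ)) :
    ∃ F G : C(I, ℝ), Xs.HasGen F G ∧ ⇑(F - G) = X.link h ∧ G 1 = 0 := by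
  obtain ⟨f, g, hfg, rfl⟩ := X.exists_hasGen_sub_eq h
  obtain ⟨F, ⟨G, hG⟩, hF⟩ := hdual.maps_domain f ⟨g, hfg⟩
  have hGl := hdual.intertwine f g F G hfg hG hF
  refine ⟨F, G, hG, hX.eq_link_of_hasDerivAt ?_ fun x hx => ?_, hX.link_gen_one_eq_zero hfg hGl⟩
  · rw [ContinuousMap.sub_apply, ContinuousMap.sub_apply, hF, hGl, link_zero, link_zero]
  · refine ((hX.hasDerivAt_of_eq_link hF hx).sub (hX.hasDerivAt_of_eq_link hGl hx)).congr_deriv ?_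
    simp only [realExt_sub, Pi.sub_apply]
    ring

/-- The range of the link is a subalgebra: `Λ h₁ · Λ h₂ = Λ (h₁ Λ h₂ + h₂ Λ h₁ - Λ h₁ Λ h₂)`. -/
def linkRange (hX : X.ReflectingOrEntrance) : Subalgebra ℝ C(I, ℝ) where
  carrier := {F | ∃ h : C(I, ℝ), ⇑F = X.link h}
  mul_mem' := by
    rintro F₁ F₂ ⟨h₁, e₁⟩ ⟨h₂, e₂⟩
    refine ⟨h₁ * F₂ + F₁ * h₂ - F₁ * F₂, hX.eq_link_of_hasDerivAt ?_ fun x hx => ?_⟩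
    · have a₁ : F₁ 0 = h₁ 0 := by rw [e₁, link_zero]
      have a₂ : F₂ 0 = h₂ 0 := by rw [e₂, link_zero]
      simp [a₁, a₂]
    · refine ((hX.hasDerivAt_of_eq_link e₁ hx).mul (hX.hasDerivAt_of_eq_link e₂ hx)).congr_deriv ?_
      have e : ∀ f g : C(I, ℝ), realExt ⇑(f * g) x = realExt f x * realExt g x := fun _ _ => rfl
      have e' : ∀ f g : C(I, ℝ), realExt ⇑(f + g) x = realExt f x + realExt g x := fun _ _ => rfl
      simp only [realExt_sub, Pi.sub_apply, e, e']
      ring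
  add_mem' := by
    rintro F₁ F₂ ⟨h₁, e₁⟩ ⟨h₂, e₂⟩
    refine ⟨h₁ + h₂, hX.eq_link_of_hasDerivAt ?_ fun x hx => ?_⟩
    · rw [ContinuousMap.add_apply, ContinuousMap.add_apply, e₁, e₂, link_zero, link_zero]
    · refine ((hX.hasDerivAt_of_eq_link e₁ hx).add (hX.hasDerivAt_of_eq_link e₂ hx)).congr_deriv ?_
      have e' : ∀ f g : C(I, ℝ), realExt ⇑(f + g) x = realExt f x + realExt g x := fun _ _ => rfl
      simp only [e']
      ring
  algebraMap_mem' := fun r => by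
    refine ⟨algebraMap ℝ C(I, ℝ) r, hX.eq_link_of_hasDerivAt rfl fun x hx => ?_⟩
    refine (hasDerivAt_const x r).congr_deriv ?_
    simp

/-- The range of the link is dense, by Stone–Weierstrass: `Λ id` is strictly increasing. -/
lemma ReflectingOrEntrance.linkRange_dense (hX : X.ReflectingOrEntrance)
    (hdual : IsStrongStationaryDual X Xs) : (linkRange hX).topologicalClosure = ⊤ := by
  refine ContinuousMap.subalgebra_topologicalClosure_eq_top_of_separatesPoints _ ?_
  set h : C(I, ℝ) := ⟨fun x => x, continuous_subtype_val⟩ with hh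
  have hid : ∀ x ∈ Icc (0 : ℝ) 1, realExt h x = x := fun x hx => by
    rw [realExt_of_mem _ hx]
    rfl
  obtain ⟨F, G, -, e, -⟩ := hX.exists_dual_resolvent hdual h
  set H := F - G with hH
  have hmono : StrictMonoOn (realExt H) (Icc 0 1) := by
    refine strictMonoOn_of_deriv_pos (convex_Icc 0 1) (continuous_realExt H).continuousOn
      fun x hx => ?_
    rw [interior_Icc] at hx
    rw [(hX.hasDerivAt_of_eq_link e hx).deriv, hid x (Ioo_subset_Icc_self hx)]
    refine mul_pos (hX.rate_pos hx) (sub_pos.2 ?_)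
    refine hX.realExt_lt_of_eq_link e (Ioo_subset_Ioc_self hx) (fun y hy => ?_)
      ⟨x / 2, ⟨half_pos hx.1, half_lt_self hx.1⟩, ?_⟩
    · rw [hid y ⟨hy.1.le, hy.2.trans hx.2.le⟩]
      exact hy.2
    · rw [hid _ ⟨(half_pos hx.1).le, by linarith [hx.1, hx.2]⟩]
      exact half_lt_self hx.1
  intro x y hxy
  refine ⟨H, ⟨H, ⟨h, e⟩, rfl⟩, fun heq => hxy ?_⟩
  rw [← realExt_coe H x, ← realExt_coe H y] at heq
  exact Subtype.ext (hmono.injOn x.2 y.2 heq)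

/-- `A* F` vanishes at `1` for every `F` in the domain of the dual: `F - A* F` is a uniform limit
of functions `Λ h`, for which this holds, and the resolvent of the dual is a contraction. -/
lemma ReflectingOrEntrance.dual_gen_one_eq_zero (hX : X.ReflectingOrEntrance)
    (hdual : IsStrongStationaryDual X Xs) {F G : C(I, ℝ)} (hFG : Xs.HasGen F G) : G 1 = 0 := by
  have hmem : F - G ∈ closure (linkRange hX : Set C(I, ℝ)) := by
    rw [← Subalgebra.topologicalClosure_coe, hX.linkRange_dense hdual]
    trivial
  refine abs_eq_zero.1 (le_antisymm (le_of_forall_pos_le_add fun ε hε => ?_) (abs_nonneg _))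
  obtain ⟨H, ⟨h, hH⟩, hdist⟩ := Metric.mem_closure_iff.1 hmem (ε / 2) (half_pos hε)
  obtain ⟨F', G', hFG', e, hz⟩ := hX.exists_dual_resolvent hdual h
  obtain rfl : F' - G' = H := DFunLike.coe_injective (e.trans hH.symm)
  have h1 := (hFG.sub hFG').norm_le
  have e2 : F - F' - (G - G') = F - G - (F' - G') := by abel
  rw [dist_eq_norm] at hdist
  rw [e2] at h1
  have e3 : G - G' = (F - F') - (F - G - (F' - G')) := by abel
  have h2 : ‖G - G'‖ ≤ ‖F - F'‖ + ‖F - G - (F' - G')‖ := by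
    conv_lhs => rw [e3]
    exact norm_sub_le _ _
  have h3 := (G - G').norm_coe_le_norm 1
  rw [ContinuousMap.sub_apply, hz, sub_zero, Real.norm_eq_abs] at h3
  linarith

end FellerDiffusion

end

theorem mainTheorem2 (X Xs : FellerDiffusion) (hreg : X.Regular)
    (h0 : X.Reflecting0 ∨ X.Entrance0) (h1 : X.Reflecting1 ∨ X.Entrance1)
    (hb : ContDiffOn ℝ 1 X.b (Ioo 0 1)) (hdual : IsStrongStationaryDual X Xs) :
    (∀ f g : C(I, ℝ), Xs.HasGen f g → ∀ x : I, (x : ℝ) ∈ Ioo (0 : ℝ) 1 →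
      g x = (1 / 2 * deriv X.b x - X.a x + X.b x * (X.statDensity x / X.statCDF x))
              * deriv (realExt f) x
            + 1 / 2 * X.b x * deriv (deriv (realExt f)) x) ∧
    Xs.Entrance0 ∧
    (X.Reflecting1 → Xs.RegularAbsorbing1) ∧
    (X.Entrance1 → Xs.Exit1) := by
  have hX : X.ReflectingOrEntrance := ⟨h0, h1⟩
  obtain ⟨hN, hS⟩ := hX.dual_boundary1 hb hdual
  refine ⟨fun f g hfg x hx => ?_, hX.dual_entrance0 hb hdual, fun hr => ?_, fun he => ?_⟩
  · obtain ⟨eb, ea⟩ := hX.dual_coefficients hb hdual hx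
    rw [Xs.gen_eq f g hfg x hx, eb, ea, FellerDiffusion.dualDrift, FellerDiffusion.rate]
    ring
  · exact ⟨⟨hN.1 hr.1.2, hS hr.1.1⟩, fun f g hfg => hX.dual_gen_one_eq_zero hdual hfg⟩
  · refine ⟨?_, hS he.1⟩
    by_contra hfin
    exact (hN.2 (lt_top_iff_ne_top.2 hfin)).ne he.2
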